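/- **Setting.** Let $\mathcal T$ be a connected closed 3-manifold triangulation: $n$ tetrahedra whose $4n$ triangular faces are affinely glued in pairs (faces of the same tetrahedron may be glued) so that the quotient space is a connected closed 3-manifold. A *vertex* of $\mathcal T$ is a class of identified tetrahedron vertices; let $v$ be the number of vertices of $\mathcal T$. Each tetrahedron has four types of normal triangle (one cutting off each vertex) and three types of normal quadrilateral (one for each partition of its vertices into two pairs). Write points of $\mathbb R^{7n}$ as $(t_{i,j},q_{i,k})$ with $1\le i\le n$, $1\le j\le 4$, $1\le k\le 3$, and points of $\mathbb R^{3n}$ as $(q_{i,k})$; the index $i$ is the tetrahedron, $j$ the triangle type and $k$ the quadrilateral type. Let $\pi:\mathbb R^{7n}\to\mathbb R^{3n}$ be the linear map that deletes the coordinates $t_{i,j}$. * The *standard matching equations* on $\mathbb R^{7n}$ say that for every pair of glued faces and each of the three types of normal arc in them, $t_{i,j}+q_{i,k}=t_{i',j'}+q_{i',k'}$, where $t_{i,j},q_{i,k}$ (respectively $t_{i',j'},q_{i',k'}$) are the triangle type and the quadrilateral type that meet the first (respectively second) face in this arc type. * The *quadrilateral matching equations* on $\mathbb R^{3n}$ say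 that for every edge $e$ of $\mathcal T$, going once around $e$ through the tetrahedra that contain it, the sum of the coordinates of the quadrilaterals that slope up along $e$ equals the sum for those that slope down. (In each tetrahedron met, exactly one of the two quadrilateral types meeting $e$ slopes up and the other slopes down.) * A point satisfies the *quadrilateral constraints* if for each $i$ at most one of $q_{i,1},q_{i,2},q_{i,3}$ is non-zero. * $\mathscr S\subset\mathbb R^{7n}$ is the polytope of non-negative solutions of the standard matching equations with coordinate sum $1$; $\mathscr Q\subset\mathbb R^{3n}$ is the polytope of non-negative solutions of the quadrilateral matching equations with coordinate sum $1$. * A face of $\mathscr S$ or $\mathscr Q$ (the empty face, of dimension $-1$, and the whole polytope included) is *admissible* if all its points satisfy the quadrilateral constraints, and *maximal admissible* if it is admissible and not properly contained in another admissible face. * The *vertex link* of a vertex $V$ of $\mathcal T$ is the vector in $\mathbb R^{7n}$ with coordinate $1$ for each triangle type cutting off a tetrahedron vertex that belongs to $V$, and all other coordinates $0$. * For a set $F$, let $F^\vee=\{\lambda x : x\in F,\ \lambda\ge 0\}$, with $\emptyset^\vee=\{0\}$. **Lemma.** For a maximal admissible face $F$ of $\mathscr S$ put $\Phi(F)=\pi(F^\vee)\cap\{q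 : \sum_{i,k} q_{i,k}=1\}$. 1. $\Phi$ is a bijection from the set of maximal admissible faces of $\mathscr S$ to the set of maximal admissible faces of $\mathscr Q$, and $\pi(F^\vee)=\Phi(F)^\vee$ for every maximal admissible face $F$ of $\mathscr S$. 2. $\dim F=\dim\Phi(F)+v$ for every maximal admissible face $F$ of $\mathscr S$; that is, $(i+v)$-faces correspond to $i$-faces for every $i\ge -1$. 3. Every maximal admissible face of $\mathscr S$ contains all $v$ vertex links, each rescaled to coordinate sum $1$. 4. The vertex links are linearly independent, and they span the space of all solutions $x\in\mathbb R^{7n}$ of the standard matching equations with $\pi(x)=0$. -/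

import Mathlib

namespace NormalSurface

/-! ### Triangulations -/

/-- A gluing of `n` abstract tetrahedra. The vertices of each tetrahedron are numbered `0, 1, 2, 3`,
and face `f` of a tetrahedron is the face opposite vertex `f`. Face `f` of tetrahedron `i` is
glued to face `perm i f f` of tetrahedron `adj i f`; the affine gluing map sends each vertex `a ≠ f`
of that face to the vertex `perm i f a`. The three laws say that the faces are glued in pairs
of distinct faces, the two faces of a pair being glued by mutually inverse maps. -/
structure Gluing (n : ℕ) where
  adj : Fin n → Fin 4 → Fin n
  perm : Fin n → Fin 4 → Equiv.Perm (Fin 4)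
  adj_adj : ∀ i f, adj (adj i f) (perm i f f) = i
  perm_perm : ∀ i f, perm (adj i f) (perm i f f) = (perm i f)⁻¹
  no_self : ∀ i f, (adj i f, perm i f f) ≠ (i, f)

/-- The elementary identifications of points of the disjoint union of the `n` solid tetrahedra,
points being given by barycentric coordinates: a point of face `f` of tetrahedron `i`
is identified with its image under the affine gluing map of that face. -/
def PointGlue {n : ℕ} (T : Gluing n) (p q : Fin n × stdSimplex ℝ (Fin 4)) : Prop :=
  ∃ f : Fin 4, (p.2 : Fin 4 → ℝ) f = 0 ∧ q.1 = T.adj p.1 f ∧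
    ∀ a, (q.2 : Fin 4 → ℝ) (T.perm p.1 f a) = (p.2 : Fin 4 → ℝ) a

/-- The underlying space of the triangulation, with the quotient topology. -/
abbrev Realization {n : ℕ} (T : Gluing n) : Type := Quot (PointGlue T)

/-- A closed 3-manifold: a compact separable metrizable space in which every point has an open
neighbourhood homeomorphic to `ℝ³`. -/
def IsClosedThreeManifold (X : Type) [TopologicalSpace X] : Prop :=
  CompactSpace X ∧ TopologicalSpace.SeparableSpace X ∧ TopologicalSpace.MetrizableSpace X ∧
    ∀ x : X, ∃ U : Set X, IsOpen U ∧ x ∈ U ∧ Nonempty (U ≃ₜ EuclideanSpace ℝ (Fin 3))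

/-- The elementary identifications of tetrahedron vertices `(i, a)`. -/
def VertexGlue {n : ℕ} (T : Gluing n) (p q : Fin n × Fin 4) : Prop :=
  ∃ f : Fin 4, p.2 ≠ f ∧ q = (T.adj p.1 f, T.perm p.1 f p.2)

/-- The vertices of the triangulation: classes of identified tetrahedron vertices. -/
abbrev Vertex {n : ℕ} (T : Gluing n) : Type := Quot (VertexGlue T)

/-- The number `v` of vertices of the triangulation. -/
noncomputable def numVertices {n : ℕ} (T : Gluing n) : ℕ := Nat.card (Vertex T)

/-! ### Coordinates and matching equations -/

/-- `ℝ^(7n)`: `x (i, Sum.inl a)` is the triangle coordinate of the triangles of tetrahedron `i` that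
cut off vertex `a`, and `x (i, Sum.inr k)` is the quadrilateral coordinate of the `k`-th type. -/
abbrev StdSpace (n : ℕ) : Type := Fin n × (Fin 4 ⊕ Fin 3) → ℝ

/-- `ℝ^(3n)`: the quadrilateral coordinates only. -/
abbrev QuadSpace (n : ℕ) : Type := Fin n × Fin 3 → ℝ

/-- The type of the quadrilaterals that separate the vertices `a ≠ b` from the other two:
type `0` is `01|23`, type `1` is `02|13` and type `2` is `03|12`.
(The diagonal entries are never used.) -/
def quadSep (a b : Fin 4) : Fin 3 :=
  !![0, 0, 1, 2;
     0, 0, 2, 1;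
     1, 2, 0, 0;
     2, 1, 0, 0] a b

/-- The quadrilateral projection `π : ℝ^(7n) → ℝ^(3n)`, which deletes the triangle coordinates. -/
def quadProj (n : ℕ) : StdSpace n →ₗ[ℝ] QuadSpace n :=
  LinearMap.funLeft ℝ ℝ (fun p : Fin n × Fin 3 => (p.1, Sum.inr p.2))

/-- Number of normal arcs around corner `a` in face `f ≠ a` of tetrahedron `i`: these arcs
come from the triangles at `a` and from the quadrilaterals separating `a` from the other two
vertices of the face, that is, separating `a, f` from the other two vertices. -/
def arcs {n : ℕ} (x : StdSpace n) (i : Fin n) (f a : Fin 4) : ℝ :=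
  x (i, Sum.inl a) + x (i, Sum.inr (quadSep a f))

/-- The standard matching equations: on any two glued faces the arcs of each of the three types
agree in number. -/
def StdMatching {n : ℕ} (T : Gluing n) (x : StdSpace n) : Prop :=
  ∀ (i : Fin n) (f a : Fin 4), a ≠ f →
    arcs x i f a = arcs x (T.adj i f) (T.perm i f f) (T.perm i f a)

/-- A tetrahedron `i` together with an ordering `a, b, c, d` of its vertices (`a = p 0`,
`b = p 1`, `c = p 2`, `d = p 3`). We see it as the edge `ab` directed from `a` to `b`, with the
direction of rotation around this edge that enters the tetrahedron through face `abc` and leaves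
it through face `abd`. -/
abbrev Flag (n : ℕ) : Type := Fin n × Equiv.Perm (Fin 4)

/-- The same directed edge of the same tetrahedron, with the reverse direction of rotation. -/
def Flag.mirror {n : ℕ} (x : Flag n) : Flag n := (x.1, x.2 * Equiv.swap 2 3)

/-- Rotation around the edge into the next tetrahedron: face `abd` (the face opposite `c`) of
tetrahedron `i` is crossed. The image of `d` becomes the new third vertex (it lies on
the face just crossed), and the vertex opposite that face, `perm i c c`, the new fourth one. -/
def rotFun {n : ℕ} (T : Gluing n) (x : Flag n) : Flag n :=
  (T.adj x.1 (x.2 2), T.perm x.1 (x.2 2) * x.2 * Equiv.swap 2 3)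

theorem Flag.mirror_mirror {n : ℕ} (x : Flag n) : x.mirror.mirror = x := by
  simp [Flag.mirror, mul_assoc]

theorem rotFun_mirror_rotFun {n : ℕ} (T : Gluing n) (x : Flag n) :
    rotFun T (rotFun T x).mirror = x.mirror := by
  simp [Flag.mirror, rotFun, mul_assoc, T.adj_adj, T.perm_perm]

/-- Rotation around edges, as a permutation of the flags. -/
def rot {n : ℕ} (T : Gluing n) : Equiv.Perm (Flag n) where
  toFun := rotFun T
  invFun x := (rotFun T x.mirror).mirror
  left_inv x := by
    show (rotFun T (rotFun T x).mirror).mirror = x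
    rw [rotFun_mirror_rotFun, Flag.mirror_mirror]
  right_inv x := by rw [rotFun_mirror_rotFun, Flag.mirror_mirror]

/-- Two of the quadrilateral types of tetrahedron `i` meet the edge `ab`, namely `ac|bd` and
`ad|bc`; going around the edge in the given direction, one of them slopes up and the other
one slopes down. This is the coordinate of the former minus the coordinate of the latter. -/
def quadSlope {n : ℕ} (y : QuadSpace n) (x : Flag n) : ℝ :=
  y (x.1, quadSep (x.2 0) (x.2 2)) - y (x.1, quadSep (x.2 0) (x.2 3))

open Classical in
/-- The quadrilateral matching equations: going once around any edge of the triangulation,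
the total of the quadrilaterals sloping up equals the total of those sloping down. (An edge of the
triangulation gives one cycle of `rot T` for each choice of directions along and around it;
these choices only affect the sign of the equation.) -/
def QuadMatching {n : ℕ} (T : Gluing n) (y : QuadSpace n) : Prop :=
  ∀ x : Flag n, ∑ z : Flag n with (rot T).SameCycle x z, quadSlope y z = 0

/-- The quadrilateral constraints: at most one non-zero quadrilateral coordinate in each
tetrahedron. -/
def QuadConstraints {n : ℕ} (y : QuadSpace n) : Prop :=
  ∀ (i : Fin n) (k l : Fin 3), y (i, k) ≠ 0 → y (i, l) ≠ 0 → k = l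

/-- The standard projective solution space `S`. -/
def stdProj {n : ℕ} (T : Gluing n) : Set (StdSpace n) :=
  {x | (∀ c, 0 ≤ x c) ∧ StdMatching T x ∧ ∑ c, x c = 1}

/-- The quadrilateral projective solution space `Q`. -/
def quadProjSpace {n : ℕ} (T : Gluing n) : Set (QuadSpace n) :=
  {y | (∀ c, 0 ≤ y c) ∧ QuadMatching T y ∧ ∑ c, y c = 1}

open Classical in
/-- The vertex link of a vertex `V` of the triangulation: one triangle at each tetrahedron
vertex that belongs to `V`, and no quadrilaterals. -/
noncomputable def vertexLink {n : ℕ} (T : Gluing n) (V : Vertex T) : StdSpace n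
  | (i, Sum.inl a) => if (Quot.mk _ (i, a) : Vertex T) = V then 1 else 0
  | (_, Sum.inr _) => 0

/-! ### Faces -/

/-- `F` is an admissible face of the polytope `P`, where `C` is the quadrilateral constraint on
points. The faces of `P` are the intersections of `P` with supporting hyperplanes,
`P` itself and the empty set, i.e. the exposed subsets in the sense of Mathlib. -/
def IsAdmissibleFace {E : Type} [TopologicalSpace E] [AddCommGroup E] [Module ℝ E]
    (C : E → Prop) (P F : Set E) : Prop :=
  IsExposed ℝ P F ∧ ∀ x ∈ F, C x

/-- The maximal admissible faces of `P`. -/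
def maxAdmissibleFaces {E : Type} [TopologicalSpace E] [AddCommGroup E] [Module ℝ E]
    (C : E → Prop) (P : Set E) : Set (Set E) :=
  {F | Maximal (IsAdmissibleFace C P) F}

/-- The maximal admissible faces of `S`. -/
def stdMaxFaces {n : ℕ} (T : Gluing n) : Set (Set (StdSpace n)) :=
  maxAdmissibleFaces (fun x => QuadConstraints (quadProj n x)) (stdProj T)

/-- The maximal admissible faces of `Q`. -/
def quadMaxFaces {n : ℕ} (T : Gluing n) : Set (Set (QuadSpace n)) :=
  maxAdmissibleFaces QuadConstraints (quadProjSpace T)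

open Classical in
/-- The dimension of a convex set: that of its affine hull, and `-1` for the empty set. -/
noncomputable def faceDim {E : Type} [AddCommGroup E] [Module ℝ E] (F : Set E) : ℤ :=
  if F.Nonempty then (Module.finrank ℝ (vectorSpan ℝ F) : ℤ) else -1

/-- The cone over `F`; the cone over the empty set is `{0}`. -/
def coneOver {E : Type} [AddCommGroup E] [Module ℝ E] (F : Set E) : Set E :=
  {0} ∪ {z | ∃ r : ℝ, 0 ≤ r ∧ ∃ x ∈ F, z = r • x}

/-- The map on faces induced by the quadrilateral projection: project the cone over `F`, and
take the cross-section with the projective hyperplane of `ℝ^(3n)`. -/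
def faceMap {n : ℕ} (F : Set (StdSpace n)) : Set (QuadSpace n) :=
  (quadProj n '' coneOver F) ∩ {y | ∑ c, y c = 1}

end NormalSurface

/-!
The kernel of the quadrilateral projection on the solutions of the standard matching equations
consists of the triangle coordinates that are constant on classes of identified tetrahedron vertices,
so the vertex links are a basis of it (`mem_span_vertexLink_iff`). The geometric heart is that every
solution `y` of the quadrilateral matching equations lifts to a solution of the standard ones
(`exists_stdMatching_quadProj_eq`). On the link of a vertex `V`, a surface made of one triangle for
each tetrahedron vertex in `V`, finding the triangle coordinates means writing a dual 1-cochain given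
by `y` as a coboundary. The quadrilateral matching equations say that this cochain is closed, hence
the restriction of a difference of numbers attached to the corners of the triangles
(`QuadMatching.exists_corner`). It remains to see that the link has no first cohomology, which is
where the manifold hypothesis enters.

For integral `y`, interpolating the corner numbers linearly over each triangle and extending radially
gives a continuous function to `ℝ / ℤ` on a punctured neighbourhood of the vertex, since the
interpolations on two glued triangles differ by an integer. A chart turns it into a function on
`ℝ³ \ {0}`, where it lifts to `ℝ` (`exists_lift_compl_zero`). On a small copy of each triangle the lift
differs from the interpolation by a constant, and these constants are the triangle coordinates
(`exists_triangles_at_vertex`). A real solution is a combination of integral ones.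

The faces of `S` and `Q` are the sets cut out by the vanishing of some coordinates
(`eq_support_of_isExposed`). The quadrilateral constraints do not involve triangle coordinates, so a
maximal admissible face of `S` is determined by the set `K` of quadrilateral coordinates that may be
non-zero on it. Such faces `stdFace T K` correspond to the faces `quadFace T K` of `Q` by the
surjectivity above: a lift becomes non-negative after adding vertex links. Dimensions are compared by
rank-nullity for the projection on the linear span of `stdFace T K`.
-/

namespace NormalSurface

open Topology

variable {n : ℕ} {T : Gluing n}

/-! ### Summation around the cycles of a permutation -/

/-- A function whose sum over every cycle of `σ` vanishes is a difference `U - U ∘ σ`. If `N` is the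
order of `σ`, then `U z = N⁻¹ ∑ k < N, (N - k) d (σ ^ k z)` does it. -/
theorem exists_sub_comp_perm_eq {α : Type*} [Fintype α] [DecidableEq α] (σ : Equiv.Perm α)
    [∀ x z, Decidable (σ.SameCycle x z)] (d : α → ℝ)
    (hd : ∀ x, ∑ z with σ.SameCycle x z, d z = 0) :
    ∃ U : α → ℝ, ∀ x, U x - U (σ x) = d x := by
  set N := orderOf σ with hN
  have hN0 : (N : ℝ) ≠ 0 := by exact_mod_cast (orderOf_pos σ).ne'
  have hcyc : ∀ (g : α → ℝ) x, ∑ z with σ.SameCycle x z, g (σ z) = ∑ z with σ.SameCycle x z, g z := by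
    intro g x
    refine Finset.sum_equiv σ (fun z => ?_) (fun _ _ => rfl)
    simp
  have hcyc' : ∀ (k : ℕ) x, ∑ z with σ.SameCycle x z, d ((σ ^ k) z) = 0 := by
    intro k x
    induction k with
    | zero => simpa using hd x
    | succ k ih => rw [← ih, ← hcyc (fun z => d ((σ ^ k) z))]; simp [pow_succ]
  have hone : σ ^ N = 1 := pow_orderOf_eq_one σ
  set S : α → ℝ := fun x => ∑ k ∈ Finset.range N, d ((σ ^ k) x) with hS
  have hSinv : ∀ x, S (σ x) = S x := by
    intro x
    have h1 : S (σ x) = ∑ k ∈ Finset.range N, d ((σ ^ (k + 1)) x) := by simp [hS, pow_succ]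
    have h2 := Finset.sum_range_succ (fun k => d ((σ ^ k) x)) N
    have h3 := Finset.sum_range_succ' (fun k => d ((σ ^ k) x)) N
    simp only [hone, pow_zero] at h2 h3
    rw [h1]; simp only [hS]; linarith
  have hSpow : ∀ (k : ℕ) x, S ((σ ^ k) x) = S x := by
    intro k x
    induction k with
    | zero => simp
    | succ k ih => rw [pow_succ', Equiv.Perm.mul_apply, hSinv, ih]
  have hS0 : ∀ x, S x = 0 := by
    intro x
    have h1 : ∑ z with σ.SameCycle x z, S z = 0 := by
      simp only [hS]; rw [Finset.sum_comm]
      exact Finset.sum_eq_zero fun k _ => hcyc' k x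
    have h2 : ∀ z ∈ Finset.univ.filter (fun z => σ.SameCycle x z), S z = S x := by
      intro z hz
      obtain ⟨k, -, rfl⟩ := (Finset.mem_filter.1 hz).2.exists_pow_eq'
      exact hSpow k x
    rw [Finset.sum_congr rfl h2, Finset.sum_const, nsmul_eq_mul, mul_eq_zero] at h1
    refine h1.resolve_left ?_
    have : x ∈ Finset.univ.filter (fun z => σ.SameCycle x z) := by
      simp [Equiv.Perm.SameCycle.refl]
    exact_mod_cast (Finset.card_pos.2 ⟨x, this⟩).ne'
  refine ⟨fun x => (N : ℝ)⁻¹ * ∑ k ∈ Finset.range N, ((N : ℝ) - k) * d ((σ ^ k) x), fun x => ?_⟩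
  have h2 := Finset.sum_range_succ (fun k : ℕ => ((N : ℝ) - k) * d ((σ ^ k) x)) N
  have h3 := Finset.sum_range_succ' (fun k : ℕ => ((N : ℝ) - k) * d ((σ ^ k) x)) N
  have h4 : ∑ k ∈ Finset.range N, ((N : ℝ) - k) * d ((σ ^ k) (σ x)) =
      ∑ k ∈ Finset.range N, ((N : ℝ) - (k + 1 : ℕ)) * d ((σ ^ (k + 1)) x) + S (σ x) := by
    simp only [hS, ← Finset.sum_add_distrib]
    refine Finset.sum_congr rfl fun k _ => ?_
    rw [pow_succ, Equiv.Perm.mul_apply]; push_cast; ring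
  rw [hS0] at h4
  simp only [sub_self, zero_mul, add_zero, Nat.cast_zero, sub_zero, pow_zero,
    Equiv.Perm.one_apply] at h2 h3 h4
  rw [← mul_sub, h4, ← h2, h3]
  field_simp
  ring

open Classical in
theorem sum_sameCycle_rot (T : Gluing n) (g : Flag n → ℝ) (x : Flag n) :
    ∑ z with (rot T).SameCycle x z, g (rotFun T z) = ∑ z with (rot T).SameCycle x z, g z := by
  refine Finset.sum_equiv (rot T) (fun z => ?_) (fun _ _ => rfl)
  simp

/-! ### Matching equations -/

/-- The change of quadrilateral coordinates when the rotation around an edge crosses a face. -/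
def crossing (T : Gluing n) (y : QuadSpace n) (z : Flag n) : ℝ :=
  y (z.1, quadSep (z.2 0) (z.2 2)) -
    y ((rotFun T z).1, quadSep ((rotFun T z).2 0) ((rotFun T z).2 3))

open Classical in
theorem sum_crossing (T : Gluing n) (y : QuadSpace n) (x : Flag n) :
    ∑ z with (rot T).SameCycle x z, crossing T y z =
      ∑ z with (rot T).SameCycle x z, quadSlope y z := by
  have := sum_sameCycle_rot T (fun z => y (z.1, quadSep (z.2 0) (z.2 3))) x
  simp only [crossing, quadSlope, Finset.sum_sub_distrib, this]

theorem StdMatching.quadMatching {x : StdSpace n} (h : StdMatching T x) :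
    QuadMatching T (quadProj n x) := by
  classical
  intro z
  have key : ∀ z : Flag n, crossing T (quadProj n x) z =
      x ((rotFun T z).1, Sum.inl ((rotFun T z).2 0)) - x (z.1, Sum.inl (z.2 0)) := by
    intro z
    have h1 := h z.1 (z.2 2) (z.2 0) (by simp)
    have e0 : Equiv.swap (2 : Fin 4) 3 0 = 0 := by decide
    simp only [arcs] at h1
    simp only [crossing, rotFun, quadProj, LinearMap.funLeft_apply, Equiv.Perm.mul_apply, e0,
      Equiv.swap_apply_right]
    linarith
  rw [← sum_crossing T, Finset.sum_congr rfl fun z _ => key z, Finset.sum_sub_distrib,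
    sum_sameCycle_rot T (fun z => x (z.1, Sum.inl (z.2 0))), sub_self]

theorem crossing_mirror_rotFun (T : Gluing n) (y : QuadSpace n) (z : Flag n) :
    crossing T y (rotFun T z).mirror = -crossing T y z := by
  have e0 : Equiv.swap (2 : Fin 4) 3 0 = 0 := by decide
  simp only [crossing, rotFun_mirror_rotFun]
  simp [Flag.mirror, e0]

theorem eq_or_eq_mul_swap : ∀ p q : Equiv.Perm (Fin 4), p 0 = q 0 → p 1 = q 1 →
    p = q ∨ p = q * Equiv.swap 2 3 := by decide

theorem exists_perm_of_ne : ∀ a b f : Fin 4, a ≠ b → a ≠ f → b ≠ f →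
    ∃ p : Equiv.Perm (Fin 4), p 0 = a ∧ p 1 = b ∧ p 2 = f := by decide

/-- The dual cochain that the quadrilateral coordinates define on a vertex link is closed around
the vertices of the link, so it is the restriction of a difference of corner values: `u i a b` is
attached to the corner on the edge `ab` of the link triangle that cuts off vertex `a` of
tetrahedron `i`. -/
theorem QuadMatching.exists_corner {y : QuadSpace n} (h : QuadMatching T y) :
    ∃ u : Fin n → Fin 4 → Fin 4 → ℝ, ∀ i f a b, a ≠ f → b ≠ f → a ≠ b →
      u i a b - u (T.adj i f) (T.perm i f a) (T.perm i f b) =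
        y (i, quadSep a f) - y (T.adj i f, quadSep (T.perm i f a) (T.perm i f f)) := by
  classical
  obtain ⟨U, hU⟩ := exists_sub_comp_perm_eq (rot T) (crossing T y)
    (fun x => (sum_crossing T y x).trans (h x))
  replace hU : ∀ z, U z - U (rotFun T z) = crossing T y z := hU
  -- Averaging over the two directions of rotation makes the corner values independent of them.
  set W : Flag n → ℝ := fun z => (U z + U z.mirror) / 2 with hW
  have hWm : ∀ z : Flag n, W z.mirror = W z := by
    intro z; simp only [hW, Flag.mirror_mirror]; ring
  have hWr : ∀ z, W z - W (rotFun T z) = crossing T y z := by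
    intro z
    have h1 := hU z
    have h2 := hU (rotFun T z).mirror
    rw [crossing_mirror_rotFun, rotFun_mirror_rotFun] at h2
    simp only [hW]; linarith
  set u : Fin n → Fin 4 → Fin 4 → ℝ := fun i a b =>
    if hp : ∃ p : Equiv.Perm (Fin 4), p 0 = a ∧ p 1 = b then W (i, hp.choose) else 0 with hu
  have hu' : ∀ i (p : Equiv.Perm (Fin 4)), u i (p 0) (p 1) = W (i, p) := by
    intro i p
    have hp : ∃ q : Equiv.Perm (Fin 4), q 0 = p 0 ∧ q 1 = p 1 := ⟨p, rfl, rfl⟩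
    simp only [hu, dif_pos hp]
    rcases eq_or_eq_mul_swap _ _ hp.choose_spec.1 hp.choose_spec.2 with h1 | h1
    · rw [h1]
    · rw [h1]; exact hWm (i, p)
  refine ⟨u, fun i f a b haf hbf hab => ?_⟩
  obtain ⟨p, rfl, rfl, rfl⟩ := exists_perm_of_ne a b f hab haf hbf
  have h1 := hWr (i, p)
  have e0 : Equiv.swap (2 : Fin 4) 3 0 = 0 := by decide
  have e1 : Equiv.swap (2 : Fin 4) 3 1 = 1 := by decide
  have h2 := hu' (T.adj i (p 2)) (T.perm i (p 2) * p * Equiv.swap 2 3)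
  simp only [Equiv.Perm.mul_apply, e0, e1] at h2
  rw [hu', h2]
  simp only [crossing, rotFun, Equiv.Perm.mul_apply, e0, Equiv.swap_apply_right] at h1
  exact h1

/-! ### Lifting circle-valued functions on punctured space -/

theorem exists_lift_of_starConvex {E : Type*} [NormedAddCommGroup E] [NormedSpace ℝ E]
    {s : Set E} {x : E} (hs : IsOpen s) (hx : x ∈ s) (hstar : StarConvex ℝ x s)
    {g : E → AddCircle (1 : ℝ)} (hg : ContinuousOn g s) :
    ∃ k : E → ℝ, ContinuousOn k s ∧ ∀ z ∈ s, (k z : AddCircle (1 : ℝ)) = g z := by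
  classical
  have := hstar.contractibleSpace ⟨x, hx⟩
  have : LocallyPathConnectedSpace s := hs.locallyPathConnectedSpace
  obtain ⟨e, he⟩ := QuotientAddGroup.mk_surjective (g x)
  obtain ⟨F, ⟨-, hF⟩, -⟩ := (AddCircle.isCoveringMap_coe (1 : ℝ)).existsUnique_continuousMap_lifts
    (⟨s.domRestrict g, hg.domRestrict⟩ : C(s, AddCircle (1 : ℝ))) (⟨x, hx⟩ : s) e he
  refine ⟨fun z => if hz : z ∈ s then F ⟨z, hz⟩ else 0, ?_, fun z hz => ?_⟩
  · rw [continuousOn_iff_continuous_domRestrict]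
    convert! F.continuous using 1
    ext z; simp
  · simp only [dif_pos hz]; exact congrFun hF ⟨z, hz⟩

/-- Two real lifts of the same circle-valued function differ by a constant on a preconnected set. -/
theorem sub_eq_sub_of_coe_eq {X : Type*} [TopologicalSpace X] {s : Set X} (hs : IsPreconnected s)
    {f g : X → ℝ} (hf : ContinuousOn f s) (hg : ContinuousOn g s)
    (h : ∀ z ∈ s, (f z : AddCircle (1 : ℝ)) = g z) {x y : X} (hx : x ∈ s) (hy : y ∈ s) :
    f x - g x = f y - g y := by
  have hint : ∀ z ∈ s, f z - g z ∈ Set.range ((↑) : ℤ → ℝ) := by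
    intro z hz
    have h1 : ((f z - g z : ℝ) : AddCircle (1 : ℝ)) = 0 := by
      rw [AddCircle.coe_sub, h z hz, sub_self]
    obtain ⟨m, hm⟩ := (AddCircle.coe_eq_zero_iff (1 : ℝ)).1 h1
    exact ⟨m, by simpa using hm⟩
  have hdisc : IsDiscrete (Set.range ((↑) : ℤ → ℝ)) :=
    Int.isClosedEmbedding_coe_real.isEmbedding.isDiscrete_range
  exact hs.constant_of_mapsTo hdisc (hf.sub hg) hint hx hy

theorem isPreconnected_compl_axis :
    IsPreconnected {z : EuclideanSpace ℝ (Fin 3) | z 1 ≠ 0 ∨ z 2 ≠ 0} := by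
  have hne : (EuclideanSpace.single (0 : Fin 3) (1 : ℝ)) ≠ 0 := by simp
  have hset : {z : EuclideanSpace ℝ (Fin 3) | z 1 ≠ 0 ∨ z 2 ≠ 0} =
      ((ℝ ∙ (EuclideanSpace.single (0 : Fin 3) (1 : ℝ)) :
        Submodule ℝ (EuclideanSpace ℝ (Fin 3))) : Set _)ᶜ := by
    ext z
    simp only [Set.mem_ofPred_eq, Set.mem_compl_iff, SetLike.mem_coe, Submodule.mem_span_singleton]
    constructor
    · rintro h ⟨a, rfl⟩
      simp at h
    · intro h
      by_contra! h'
      refine h ⟨z 0, ?_⟩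
      ext i; fin_cases i <;> simp [h'.1, h'.2]
  rw [hset]
  refine (isConnected_compl_of_one_lt_codim ?_).isPreconnected
  rw [← Module.finrank_eq_rank, ← Nat.cast_one, Nat.cast_lt]
  have h1 := Submodule.finrank_quotient_add_finrank
    (ℝ ∙ (EuclideanSpace.single (0 : Fin 3) (1 : ℝ)))
  rw [finrank_span_singleton hne, finrank_euclideanSpace_fin] at h1
  omega

theorem starConvex_compl_ray (s : ℝ) (hs : s ≠ 0) :
    StarConvex ℝ (EuclideanSpace.single (0 : Fin 3) s)
      {z : EuclideanSpace ℝ (Fin 3) | 0 < s * z 0 ∨ z 1 ≠ 0 ∨ z 2 ≠ 0} := by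
  intro z hz a b ha hb hab
  have hss : 0 < s * s := mul_self_pos.2 hs
  simp only [Set.mem_ofPred_eq, PiLp.add_apply, PiLp.smul_apply, PiLp.single_apply,
    smul_eq_mul, if_true, if_neg (show (1 : Fin 3) ≠ 0 by decide),
    if_neg (show (2 : Fin 3) ≠ 0 by decide), mul_zero, zero_add] at hz ⊢
  rcases hb.eq_or_lt with rfl | hb
  · left
    have ha1 : a = 1 := by linarith
    subst ha1; linarith
  · rcases hz with hz | hz | hz
    · left; nlinarith [mul_nonneg ha hss.le, mul_pos hb hz]
    · exact Or.inr (Or.inl (mul_ne_zero hb.ne' hz))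
    · exact Or.inr (Or.inr (mul_ne_zero hb.ne' hz))

theorem isOpen_compl_ray (s : ℝ) :
    IsOpen {z : EuclideanSpace ℝ (Fin 3) | 0 < s * z 0 ∨ z 1 ≠ 0 ∨ z 2 ≠ 0} := by
  have hc : ∀ i : Fin 3, Continuous fun z : EuclideanSpace ℝ (Fin 3) => z i := fun i => by fun_prop
  exact (isOpen_lt continuous_const (continuous_const.mul (hc 0))).union
    ((isOpen_ne_fun (hc 1) continuous_const).union (isOpen_ne_fun (hc 2) continuous_const))

/-- Circle-valued functions on punctured 3-space have real lifts: the complements of two opposite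
rays are star-convex, and they meet in the complement of a line, which is connected. This is the form
in which the simple connectivity of the 2-sphere is used. -/
theorem exists_lift_compl_zero {g : EuclideanSpace ℝ (Fin 3) → AddCircle (1 : ℝ)}
    (hg : ContinuousOn g {0}ᶜ) :
    ∃ k : EuclideanSpace ℝ (Fin 3) → ℝ, ContinuousOn k {0}ᶜ ∧
      ∀ z, z ≠ 0 → (k z : AddCircle (1 : ℝ)) = g z := by
  classical
  set A : ℝ → Set (EuclideanSpace ℝ (Fin 3)) :=
    fun s => {z | 0 < s * z 0 ∨ z 1 ≠ 0 ∨ z 2 ≠ 0} with hA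
  have hA0 : ∀ s, A s ⊆ {0}ᶜ := by
    rintro s z hz rfl
    simp [hA] at hz
  have hlift : ∀ s : ℝ, s ≠ 0 → ∃ k : EuclideanSpace ℝ (Fin 3) → ℝ, ContinuousOn k (A s) ∧
      ∀ z ∈ A s, (k z : AddCircle (1 : ℝ)) = g z := fun s hs =>
    exists_lift_of_starConvex (isOpen_compl_ray s)
      (show EuclideanSpace.single (0 : Fin 3) s ∈ A s from
        Or.inl (by simpa using mul_self_pos.2 hs))
      (starConvex_compl_ray s hs) (hg.mono (hA0 s))
  obtain ⟨k₁, hk₁, hl₁⟩ := hlift 1 one_ne_zero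
  obtain ⟨k₂, hk₂, hl₂⟩ := hlift (-1) (by norm_num)
  have haxis : ∀ s, {z : EuclideanSpace ℝ (Fin 3) | z 1 ≠ 0 ∨ z 2 ≠ 0} ⊆ A s :=
    fun s z hz => Or.inr hz
  have hcover : ∀ z : EuclideanSpace ℝ (Fin 3), z ≠ 0 → z ∈ A 1 ∨ z ∈ A (-1) := by
    intro z hz
    by_contra! h
    simp only [hA, Set.mem_ofPred_eq, not_or, not_lt, not_not] at h
    refine hz ?_
    ext i; fin_cases i
    · simp; linarith [h.1.1, h.2.1]
    · simpa using h.1.2.1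
    · simpa using h.1.2.2
  have hboth : A 1 ∩ A (-1) ⊆ {z : EuclideanSpace ℝ (Fin 3) | z 1 ≠ 0 ∨ z 2 ≠ 0} := by
    rintro z ⟨h1 | h1, h2 | h2⟩
    · linarith
    all_goals assumption
  -- Shift the second lift by the constant difference on the intersection.
  obtain ⟨p, hp⟩ : ∃ p : EuclideanSpace ℝ (Fin 3), p 1 ≠ 0 ∨ p 2 ≠ 0 :=
    ⟨EuclideanSpace.single 1 1, by simp⟩
  have hdiff : ∀ z ∈ A 1 ∩ A (-1), k₂ z + (k₁ p - k₂ p) = k₁ z := by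
    intro z hz
    have := sub_eq_sub_of_coe_eq isPreconnected_compl_axis (hk₁.mono (haxis 1))
      (hk₂.mono (haxis (-1)))
      (fun z hz => (hl₁ z (haxis 1 hz)).trans (hl₂ z (haxis (-1) hz)).symm) hp (hboth hz)
    linarith
  have hc : ((k₁ p - k₂ p : ℝ) : AddCircle (1 : ℝ)) = 0 := by
    rw [AddCircle.coe_sub, hl₁ p (haxis 1 hp), hl₂ p (haxis (-1) hp), sub_self]
  set k : EuclideanSpace ℝ (Fin 3) → ℝ :=
    fun z => if z ∈ A 1 then k₁ z else k₂ z + (k₁ p - k₂ p) with hk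
  have hkk₁ : Set.EqOn k k₁ (A 1) := fun z hz => by simp [hk, hz]
  have hkk₂ : Set.EqOn k (fun z => k₂ z + (k₁ p - k₂ p)) (A (-1)) := by
    intro z hz
    by_cases h : z ∈ A 1
    · simp only [hk, h, if_true]; exact (hdiff z ⟨h, hz⟩).symm
    · simp [hk, h]
  refine ⟨k, fun z hz => ?_, fun z hz => ?_⟩
  · refine ContinuousAt.continuousWithinAt ?_
    rcases hcover z hz with h | h
    · exact (hk₁.congr hkk₁).continuousAt ((isOpen_compl_ray 1).mem_nhds h)
    · exact ((hk₂.add continuousOn_const).congr hkk₂).continuousAt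
        ((isOpen_compl_ray (-1)).mem_nhds h)
  · rcases hcover z hz with h | h
    · rw [hkk₁ h, hl₁ z h]
    · rw [hkk₂ h, AddCircle.coe_add, hc, add_zero, hl₂ z h]

/-! ### Neighbourhoods of a vertex in the realization -/

theorem PointGlue.exists_coord_iff {z z' : Fin n × stdSimplex ℝ (Fin 4)} (h : PointGlue T z z')
    (V : Vertex T) {R : ℝ → Prop} (hR : ¬R 0) :
    (∃ a, R (z.2 a) ∧ (Quot.mk _ (z.1, a) : Vertex T) = V) ↔
      ∃ a, R (z'.2 a) ∧ (Quot.mk _ (z'.1, a) : Vertex T) = V := by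
  obtain ⟨f, hf, hadj, hperm⟩ := h
  have key : ∀ a, (R (z.2 a) ∧ (Quot.mk _ (z.1, a) : Vertex T) = V) ↔
      (R (z'.2 (T.perm z.1 f a)) ∧ (Quot.mk _ (z'.1, T.perm z.1 f a) : Vertex T) = V) := by
    intro a
    have h1 : z'.2 (T.perm z.1 f a) = z.2 a := hperm a
    rw [h1]
    refine and_congr_right fun h2 => ?_
    have haf : a ≠ f := by
      rintro rfl
      exact hR (by rwa [show z.2 a = 0 from hf] at h2)
    have h3 : (Quot.mk _ (z.1, a) : Vertex T) = Quot.mk _ (z'.1, T.perm z.1 f a) :=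
      Quot.sound ⟨f, haf, by rw [hadj]⟩
    rw [h3]
  constructor
  · rintro ⟨a, ha⟩
    exact ⟨_, (key a).1 ha⟩
  · rintro ⟨a, ha⟩
    refine ⟨(T.perm z.1 f).symm a, (key _).2 ?_⟩
    simpa using ha

/-- The points of the realization that have a barycentric coordinate with the property `R` at a
tetrahedron vertex that belongs to `V`. -/
def coordLocus (T : Gluing n) (V : Vertex T) (R : ℝ → Prop) (hR : ¬R 0) : Set (Realization T) :=
  {x | Quot.lift (fun z : Fin n × stdSimplex ℝ (Fin 4) =>
    ∃ a, R (z.2 a) ∧ (Quot.mk _ (z.1, a) : Vertex T) = V)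
    (fun _ _ h => propext (h.exists_coord_iff V hR)) x}

theorem mk_mem_coordLocus {V : Vertex T} {R : ℝ → Prop} {hR : ¬R 0}
    {z : Fin n × stdSimplex ℝ (Fin 4)} :
    (Quot.mk _ z : Realization T) ∈ coordLocus T V R hR ↔
      ∃ a, R (z.2 a) ∧ (Quot.mk _ (z.1, a) : Vertex T) = V := Iff.rfl

theorem isQuotientMap_mk (T : Gluing n) :
    Topology.IsQuotientMap (Quot.mk (PointGlue T) : _ → Realization T) := isQuotientMap_quot_mk

theorem continuous_coord (a : Fin 4) :
    Continuous fun z : Fin n × stdSimplex ℝ (Fin 4) => z.2 a :=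
  (continuous_apply a).comp (continuous_subtype_val.comp continuous_snd)

theorem isOpen_coordLocus (V : Vertex T) {R : ℝ → Prop} {hR : ¬R 0} (hopen : IsOpen {r | R r}) :
    IsOpen (coordLocus T V R hR) := by
  rw [← (isQuotientMap_mk T).isOpen_preimage]
  have : Quot.mk (PointGlue T) ⁻¹' coordLocus T V R hR =
      ⋃ a, {z | R (z.2 a)} ∩ {z | (Quot.mk _ (z.1, a) : Vertex T) = V} := by
    ext z
    simp only [Set.mem_preimage, mk_mem_coordLocus, Set.mem_iUnion, Set.mem_inter_iff,
      Set.mem_ofPred_eq]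
  rw [this]
  refine isOpen_iUnion fun a => (hopen.preimage (continuous_coord a)).inter ?_
  exact (isOpen_discrete {i : Fin n | (Quot.mk _ (i, a) : Vertex T) = V}).preimage continuous_fst

/-- The point with barycentric coordinates `1 - δ` at vertex `a` and `δ` at vertex `b`; vertex `a`
itself for `a = b`. -/
noncomputable def edgePoint (δ : ℝ) (hδ : 0 ≤ δ ∧ δ ≤ 1) (a b : Fin 4) : stdSimplex ℝ (Fin 4) :=
  ⟨(1 - δ) • Pi.single a 1 + δ • Pi.single b 1,
    convex_stdSimplex ℝ (Fin 4) (single_mem_stdSimplex ℝ a) (single_mem_stdSimplex ℝ b)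
      (by linarith) hδ.1 (by ring)⟩

theorem edgePoint_apply {δ : ℝ} (hδ : 0 ≤ δ ∧ δ ≤ 1) (a b c : Fin 4) :
    edgePoint δ hδ a b c = (1 - δ) * (if c = a then 1 else 0) + δ * (if c = b then 1 else 0) := by
  show ((1 - δ) • Pi.single a 1 + δ • Pi.single b 1 : Fin 4 → ℝ) c = _
  simp [Pi.single_apply]

theorem edgePoint_apply_left {δ : ℝ} (hδ : 0 ≤ δ ∧ δ ≤ 1) {a b : Fin 4} (h : a ≠ b) :
    edgePoint δ hδ a b a = 1 - δ := by simp [edgePoint_apply, h]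

theorem pointGlue_edgePoint (T : Gluing n) {δ : ℝ} (hδ : 0 ≤ δ ∧ δ ≤ 1) (i : Fin n) {f a b : Fin 4}
    (ha : a ≠ f) (hb : b ≠ f) :
    PointGlue T (i, edgePoint δ hδ a b)
      (T.adj i f, edgePoint δ hδ (T.perm i f a) (T.perm i f b)) := by
  refine ⟨f, ?_, rfl, fun c => ?_⟩
  · show edgePoint δ hδ a b f = 0
    simp [edgePoint_apply, ha.symm, hb.symm]
  · show edgePoint δ hδ _ _ _ = edgePoint δ hδ a b c
    simp [edgePoint_apply]

theorem coord_add_le_one (p : stdSimplex ℝ (Fin 4)) {a b : Fin 4} (h : a ≠ b) : p a + p b ≤ 1 := by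
  have h1 : ∑ c, p c = 1 := p.2.2
  rw [← h1, ← Finset.sum_pair h]
  exact Finset.sum_le_sum_of_subset_of_nonneg (Finset.subset_univ _) fun c _ _ => p.2.1 c

theorem coord_eq_zero_of_eq_one {p : stdSimplex ℝ (Fin 4)} {a : Fin 4} (hp : p a = 1) {b : Fin 4}
    (hb : b ≠ a) : p b = 0 :=
  le_antisymm (by linarith [coord_add_le_one p hb]) (p.2.1 b)

theorem eq_vertex {p : stdSimplex ℝ (Fin 4)} {a : Fin 4} (hp : p a = 1) :
    p = edgePoint 0 ⟨le_rfl, zero_le_one⟩ a a := by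
  ext b
  show p b = edgePoint 0 _ a a b
  rw [edgePoint_apply]
  by_cases hb : b = a
  · simp [hb, hp]
  · simp [hb, coord_eq_zero_of_eq_one hp hb]

/-- The point of the realization that carries a vertex of the triangulation. -/
noncomputable def vertexPoint (T : Gluing n) : Vertex T → Realization T :=
  Quot.lift (fun p => Quot.mk _ (p.1, edgePoint 0 ⟨le_rfl, zero_le_one⟩ p.2 p.2)) (by
    rintro ⟨i, a⟩ q ⟨f, haf, rfl⟩
    exact Quot.sound (pointGlue_edgePoint T _ i haf haf))

theorem mk_eq_vertexPoint {z : Fin n × stdSimplex ℝ (Fin 4)} {a : Fin 4} (hz : z.2 a = 1) :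
    (Quot.mk _ z : Realization T) = vertexPoint T (Quot.mk _ (z.1, a)) := by
  obtain ⟨i, p⟩ := z
  rw [show p = _ from eq_vertex hz]; rfl

theorem vertexPoint_mem_coordLocus (V : Vertex T) {R : ℝ → Prop} {hR : ¬R 0} (h1 : R 1) :
    vertexPoint T V ∈ coordLocus T V R hR := by
  induction V using Quot.ind with | _ p =>
  refine mk_mem_coordLocus.2 ⟨p.2, ?_, rfl⟩
  simpa [edgePoint_apply] using h1

theorem mk_ne_vertexPoint {z : Fin n × stdSimplex ℝ (Fin 4)} {V : Vertex T}
    (hz : ∀ a, z.2 a < 1) : (Quot.mk _ z : Realization T) ≠ vertexPoint T V := by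
  intro h
  have h1 := vertexPoint_mem_coordLocus V (R := fun r => r = 1) (hR := by norm_num) rfl
  rw [← h] at h1
  obtain ⟨a, ha, -⟩ := mk_mem_coordLocus.1 h1
  exact (hz a).ne ha

/-! ### A circle-valued function near the vertices -/

/-- The linear interpolation of the corner values `u i a b`, `b ≠ a`, over the triangle that cuts
off vertex `a` of tetrahedron `i`, extended radially from `a`. -/
noncomputable def interp (u : Fin n → Fin 4 → Fin 4 → ℝ) (i : Fin n) (a : Fin 4)
    (p : stdSimplex ℝ (Fin 4)) : ℝ :=
  ∑ b, if b = a then 0 else u i a b * (p b / (1 - p a))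

/-- The class of `interp` in the circle, near the vertices of the tetrahedra. At most one
coordinate exceeds `1 / 2`, so at most one summand is not zero. -/
noncomputable def linkCircle (u : Fin n → Fin 4 → Fin 4 → ℝ) (z : Fin n × stdSimplex ℝ (Fin 4)) :
    AddCircle (1 : ℝ) :=
  ∑ a, if 1 / 2 < z.2 a then ((interp u z.1 a z.2 : ℝ) : AddCircle (1 : ℝ)) else 0

theorem linkCircle_eq (u : Fin n → Fin 4 → Fin 4 → ℝ) {z : Fin n × stdSimplex ℝ (Fin 4)}
    {a : Fin 4} (ha : 1 / 2 < z.2 a) :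
    linkCircle u z = ((interp u z.1 a z.2 : ℝ) : AddCircle (1 : ℝ)) := by
  rw [linkCircle, Finset.sum_eq_single a, if_pos ha]
  · intro b _ hb
    rw [if_neg]
    linarith [coord_add_le_one z.2 hb]
  · simp

theorem interp_edgePoint (u : Fin n → Fin 4 → Fin 4 → ℝ) (i : Fin n) {a b : Fin 4} (hab : a ≠ b)
    {δ : ℝ} (hδ : 0 ≤ δ ∧ δ ≤ 1) (hδ0 : δ ≠ 0) :
    interp u i a (edgePoint δ hδ a b) = u i a b := by
  rw [interp, Finset.sum_eq_single b, if_neg hab.symm]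
  · simp [edgePoint_apply, hab, hab.symm, hδ0]
  · intro c _ hc
    by_cases hca : c = a
    · simp [hca]
    · simp [edgePoint_apply, hca, hc]
  · simp

theorem continuousAt_interp (u : Fin n → Fin 4 → Fin 4 → ℝ) (i : Fin n) (a : Fin 4)
    {p : stdSimplex ℝ (Fin 4)} (hp : p a < 1) : ContinuousAt (interp u i a) p := by
  unfold interp
  have hc : ∀ b, Continuous fun p : stdSimplex ℝ (Fin 4) => p b := fun b =>
    (continuous_apply b).comp continuous_subtype_val
  refine tendsto_finsetSum _ fun b _ => ?_
  by_cases hb : b = a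
  · simp only [if_pos hb]; exact tendsto_const_nhds
  · simp only [if_neg hb]
    exact continuousAt_const.mul ((hc b).continuousAt.div (continuousAt_const.sub
      (hc a).continuousAt) (by linarith))

theorem continuousAt_linkCircle (u : Fin n → Fin 4 → Fin 4 → ℝ)
    {z : Fin n × stdSimplex ℝ (Fin 4)} {a : Fin 4} (ha : 1 / 2 < z.2 a) (ha1 : z.2 a < 1) :
    ContinuousAt (linkCircle u) z := by
  have hopen : IsOpen {z' : Fin n × stdSimplex ℝ (Fin 4) | z'.1 = z.1 ∧ 1 / 2 < z'.2 a} :=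
    ((isOpen_discrete {z.1}).preimage continuous_fst).inter
      (isOpen_lt continuous_const (continuous_coord a))
  have hev : linkCircle u =ᶠ[nhds z]
      fun z' => ((interp u z.1 a z'.2 : ℝ) : AddCircle (1 : ℝ)) := by
    filter_upwards [hopen.mem_nhds ⟨rfl, ha⟩] with z' hz'
    rw [linkCircle_eq u hz'.2, hz'.1]
  refine ContinuousAt.congr ?_ hev.symm
  exact (AddCircle.continuous_mk' (1 : ℝ)).continuousAt.comp
    ((continuousAt_interp u z.1 a ha1).comp (f := Prod.snd) continuousAt_snd)

/-- The corner values of two glued triangles differ by the same integer at both ends of the common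
edge, so the circle-valued function descends to the realization. -/
theorem linkCircle_eq_of_pointGlue {y : QuadSpace n} (hy : ∀ c, ∃ m : ℤ, y c = m)
    {u : Fin n → Fin 4 → Fin 4 → ℝ}
    (hu : ∀ i f a b, a ≠ f → b ≠ f → a ≠ b →
      u i a b - u (T.adj i f) (T.perm i f a) (T.perm i f b) =
        y (i, quadSep a f) - y (T.adj i f, quadSep (T.perm i f a) (T.perm i f f)))
    {z z' : Fin n × stdSimplex ℝ (Fin 4)} (h : PointGlue T z z') :
    linkCircle u z = linkCircle u z' := by
  obtain ⟨i, p⟩ := z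
  obtain ⟨i', p'⟩ := z'
  obtain ⟨f, hf, hadj, hperm⟩ := h
  replace hadj : i' = T.adj i f := hadj
  subst hadj
  replace hf : p f = 0 := hf
  replace hperm : ∀ a, p' (T.perm i f a) = p a := hperm
  unfold linkCircle
  rw [← Equiv.sum_comp (T.perm i f)
    (fun a => if 1 / 2 < p' a then ((interp u (T.adj i f) a p' : ℝ) : AddCircle (1 : ℝ)) else 0)]
  refine Finset.sum_congr rfl fun a _ => ?_
  show (if 1 / 2 < p a then _ else _) = _
  rw [hperm]
  split_ifs with ha
  swap
  · rfl
  have haf : a ≠ f := by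
    rintro rfl
    rw [hf] at ha; norm_num at ha
  set c := y (i, quadSep a f) - y (T.adj i f, quadSep (T.perm i f a) (T.perm i f f)) with hc
  have hcint : ∃ m : ℤ, c = m := by
    obtain ⟨m₁, h₁⟩ := hy (i, quadSep a f)
    obtain ⟨m₂, h₂⟩ := hy (T.adj i f, quadSep (T.perm i f a) (T.perm i f f))
    exact ⟨m₁ - m₂, by rw [hc, h₁, h₂]; push_cast; rfl⟩
  obtain ⟨m, hm⟩ := hcint
  have hdiff : interp u i a p - interp u (T.adj i f) (T.perm i f a) p' =
      c * ((1 - p a) / (1 - p a)) := by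
    have h1 : interp u (T.adj i f) (T.perm i f a) p' = ∑ b, if b = a then 0 else
        u (T.adj i f) (T.perm i f a) (T.perm i f b) * (p b / (1 - p a)) := by
      rw [interp, ← Equiv.sum_comp (T.perm i f)]
      simp only [hperm, EmbeddingLike.apply_eq_iff_eq]
    have h2 : 1 - p a = ∑ b, if b = a then 0 else p b := by
      have h3 : ∑ b, p b = 1 := p.2.2
      rw [← h3, ← Finset.add_sum_erase _ _ (Finset.mem_univ a), add_sub_cancel_left,
        ← Finset.filter_ne', Finset.sum_filter]
      simp only [ne_eq, ite_not]
    have h4 : (1 - p a) / (1 - p a) = ∑ b, (if b = a then 0 else p b) / (1 - p a) := by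
      rw [← Finset.sum_div, ← h2]
    rw [h1, interp, ← Finset.sum_sub_distrib, h4, Finset.mul_sum]
    refine Finset.sum_congr rfl fun b _ => ?_
    by_cases hb : b = a
    · simp [hb]
    · simp only [if_neg hb]
      by_cases hbf : b = f
      · simp [hbf, hf]
      · rw [← sub_mul, hu i f a b haf hbf (Ne.symm hb)]
  rw [← sub_eq_zero, ← AddCircle.coe_sub, hdiff, hm]
  -- For `p a = 1` the quotient is `0 / 0 = 0`.
  by_cases hp : 1 - p a = 0
  · simp [hp]
  · rw [div_self hp, mul_one]
    exact (AddCircle.coe_eq_zero_iff (1 : ℝ)).2 ⟨m, by simp⟩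

/-! ### Vertex links of a manifold have no first cohomology -/

/-- Every point of `X` has an open neighbourhood homeomorphic to `ℝ³`. -/
def IsLocallyEuclideanThree (X : Type) [TopologicalSpace X] : Prop :=
  ∀ x : X, ∃ U : Set X, IsOpen U ∧ x ∈ U ∧ Nonempty (U ≃ₜ EuclideanSpace ℝ (Fin 3))

theorem exists_ball_chart {X : Type} [TopologicalSpace X] {x₀ : X} {S : Set X} (hS : IsOpen S)
    (hx₀ : x₀ ∈ S)
    (h : ∃ U : Set X, IsOpen U ∧ x₀ ∈ U ∧ Nonempty (U ≃ₜ EuclideanSpace ℝ (Fin 3))) :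
    ∃ ψ : EuclideanSpace ℝ (Fin 3) → X, IsOpenEmbedding ψ ∧ ψ 0 = x₀ ∧ Set.range ψ ⊆ S := by
  obtain ⟨U, hU, hxU, ⟨e⟩⟩ := h
  have hemb : IsOpenEmbedding (Subtype.val ∘ e.symm : EuclideanSpace ℝ (Fin 3) → X) :=
    hU.isOpenEmbedding_subtypeVal.comp e.symm.isOpenEmbedding
  set c := e ⟨x₀, hxU⟩ with hc
  have hcx : (Subtype.val ∘ e.symm : EuclideanSpace ℝ (Fin 3) → X) c = x₀ := by simp [hc]
  obtain ⟨r, hr, hball⟩ := Metric.isOpen_iff.1 (hS.preimage hemb.continuous) c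
    (by rw [Set.mem_preimage, hcx]; exact hx₀)
  have hb : IsOpenEmbedding (OpenPartialHomeomorph.univBall c r) :=
    OpenPartialHomeomorph.isOpenEmbedding _ (OpenPartialHomeomorph.univBall_source c r)
  refine ⟨_, hemb.comp hb, ?_, ?_⟩
  · rw [Function.comp_apply, OpenPartialHomeomorph.univBall_apply_zero, hcx]
  · rintro _ ⟨z, rfl⟩
    refine hball ?_
    rw [← OpenPartialHomeomorph.univBall_target c hr]
    exact (OpenPartialHomeomorph.univBall c r).map_source
      (by rw [OpenPartialHomeomorph.univBall_source]; trivial)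

theorem isPreconnected_slice (a : Fin 4) (s : ℝ) :
    IsPreconnected {p : stdSimplex ℝ (Fin 4) | p a = s} := by
  rw [← IsInducing.subtypeVal.isPreconnected_image]
  have : Subtype.val '' {p : stdSimplex ℝ (Fin 4) | p a = s} =
      stdSimplex ℝ (Fin 4) ∩ {q | q a = s} := by
    ext q
    constructor
    · rintro ⟨p, hp, rfl⟩
      exact ⟨p.2, hp⟩
    · rintro ⟨h1, h2⟩
      exact ⟨⟨q, h1⟩, h2, rfl⟩
  rw [this]
  refine ((convex_stdSimplex ℝ (Fin 4)).inter ?_).isPreconnected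
  exact convex_hyperplane (LinearMap.proj (R := ℝ) (φ := fun _ : Fin 4 => ℝ) a).isLinear s

theorem eventually_mem_of_mem_nhds_vertex {a : Fin 4} {N : Set (stdSimplex ℝ (Fin 4))}
    (hN : N ∈ 𝓝 (edgePoint 0 ⟨le_rfl, zero_le_one⟩ a a)) :
    ∀ᶠ δ : ℝ in 𝓝[>] 0, ∀ p : stdSimplex ℝ (Fin 4), p a = 1 - δ → p ∈ N := by
  obtain ⟨ε, hε, hball⟩ := Metric.mem_nhds_iff.1 hN
  filter_upwards [Ioo_mem_nhdsGT hε] with δ hδ p hp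
  refine hball ?_
  rw [Metric.mem_ball, Subtype.dist_eq, dist_pi_lt_iff hε]
  intro b
  show dist (p b) (edgePoint 0 _ a a b) < ε
  rw [edgePoint_apply, Real.dist_eq]
  by_cases hb : b = a
  · subst hb
    simp only [if_true]
    rw [hp, abs_lt]
    constructor <;> linarith [hδ.1, hδ.2]
  · have h1 := coord_add_le_one p hb
    have h2 : 0 ≤ p b := p.2.1 b
    simp only [if_neg hb]
    rw [abs_lt]
    constructor <;> linarith [hδ.1, hδ.2]

theorem exists_ne_ne : ∀ a f : Fin 4, ∃ b, b ≠ a ∧ b ≠ f := by decide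

/-- The integral cochain that an integral solution of the quadrilateral matching equations defines
on a vertex link is a coboundary. -/
theorem exists_triangles_at_vertex
    (hman : IsLocallyEuclideanThree (Realization T))
    {y : QuadSpace n} (hy : ∀ c, ∃ m : ℤ, y c = m) (hQ : QuadMatching T y) (V : Vertex T) :
    ∃ t : Fin n → Fin 4 → ℝ, ∀ i f a, a ≠ f → (Quot.mk _ (i, a) : Vertex T) = V →
      t i a + y (i, quadSep a f) =
        t (T.adj i f) (T.perm i f a) + y (T.adj i f, quadSep (T.perm i f a) (T.perm i f f)) := by
  obtain ⟨u, hu⟩ := hQ.exists_corner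
  set x₀ := vertexPoint T V with hx₀
  set g : Realization T → AddCircle (1 : ℝ) :=
    Quot.lift (linkCircle u) (fun _ _ h => linkCircle_eq_of_pointGlue hy hu h) with hg
  have hhalf : ¬(1 / 2 : ℝ) < 0 := by norm_num
  set S := coordLocus T V (fun r => 1 / 2 < r) hhalf with hS
  have hSo : IsOpen S := isOpen_coordLocus V (isOpen_lt continuous_const continuous_id)
  obtain ⟨ψ, hψ, hψ0, hψS⟩ := exists_ball_chart hSo
    (vertexPoint_mem_coordLocus V (by norm_num)) (hman x₀)
  -- The function `g` is continuous near the vertex, except at the vertex itself.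
  have hgc : ContinuousOn (g ∘ ψ) {0}ᶜ := by
    have hO : IsOpen (ψ '' {0}ᶜ) := hψ.isOpenMap _ isOpen_compl_singleton
    have h1 : ContinuousOn g (ψ '' {0}ᶜ) := by
      refine ((isQuotientMap_mk T).continuousOn_isOpen_iff hO).2 ?_
      intro z hz
      obtain ⟨w, hw, hwz⟩ := hz
      have hzS : (Quot.mk _ z : Realization T) ∈ S := by rw [← hwz]; exact hψS ⟨w, rfl⟩
      obtain ⟨a, ha, haV⟩ := mk_mem_coordLocus.1 hzS
      refine (continuousAt_linkCircle u ha (lt_of_le_of_ne ?_ ?_)).continuousWithinAt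
      · obtain ⟨b, hb, -⟩ := exists_ne_ne a a
        have h2 : 0 ≤ z.2 b := z.2.2.1 b
        linarith [coord_add_le_one z.2 hb]
      · intro h3
        refine hw (hψ.injective ?_)
        rw [hwz, hψ0, mk_eq_vertexPoint h3, haV]
    exact h1.comp hψ.continuous.continuousOn (fun z hz => ⟨z, hz, rfl⟩)
  obtain ⟨k, hk, hkg⟩ := exists_lift_compl_zero hgc
  set Φ := hψ.toOpenPartialHomeomorph with hΦ
  set O := Set.range ψ with hOdef
  have hOo : IsOpen O := hψ.isOpen_range
  have hφ : ContinuousOn Φ.symm O := by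
    have := Φ.continuousOn_symm
    simpa [hΦ] using this
  have hφψ : ∀ x ∈ O, ψ (Φ.symm x) = x := by
    intro x hx
    exact Φ.right_inv (by simpa [hΦ, hOdef] using hx)
  have hφ0 : ∀ x ∈ O, x ≠ x₀ → Φ.symm x ≠ 0 := by
    intro x hx hne h
    exact hne (by rw [← hφψ x hx, h, hψ0])
  set K : Realization T → ℝ := k ∘ Φ.symm with hK
  have hKc : ContinuousOn K (O \ {x₀}) :=
    hk.comp (hφ.mono Set.sdiff_subset) (fun x hx => hφ0 x hx.1 hx.2)
  have hKg : ∀ x ∈ O, x ≠ x₀ → (K x : AddCircle (1 : ℝ)) = g x := by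
    intro x hx hne
    rw [hK, Function.comp_apply, hkg _ (hφ0 x hx hne), Function.comp_apply, hφψ x hx]
  -- The small triangles around the vertex lie in the ball.
  obtain ⟨δ, hδO, hδ0, hδ1⟩ : ∃ δ : ℝ, (∀ i a, (Quot.mk _ (i, a) : Vertex T) = V →
      ∀ p : stdSimplex ℝ (Fin 4), p a = 1 - δ → (Quot.mk _ (i, p) : Realization T) ∈ O) ∧
      0 < δ ∧ δ < 1 / 2 := by
    have hev : ∀ᶠ δ : ℝ in 𝓝[>] 0, ∀ i a, (Quot.mk _ (i, a) : Vertex T) = V →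
      ∀ p : stdSimplex ℝ (Fin 4), p a = 1 - δ → (Quot.mk _ (i, p) : Realization T) ∈ O := by
      rw [Filter.eventually_all]; intro i
      rw [Filter.eventually_all]; intro a
      by_cases hV : (Quot.mk _ (i, a) : Vertex T) = V
      · refine (eventually_mem_of_mem_nhds_vertex (N := {p | (Quot.mk _ (i, p) : Realization T) ∈ O})
          ?_).mono fun δ h _ => h
        have hc : Continuous fun p : stdSimplex ℝ (Fin 4) => (Quot.mk _ (i, p) : Realization T) :=
          (isQuotientMap_mk T).continuous.comp (Continuous.prodMk_right i)
        refine (hOo.preimage hc).mem_nhds ?_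
        show (Quot.mk _ (i, edgePoint 0 _ a a) : Realization T) ∈ O
        rw [mk_eq_vertexPoint (a := a) (by simp [edgePoint_apply]), hV]
        exact ⟨0, hψ0⟩
      · exact Filter.Eventually.of_forall fun δ h => absurd h hV
    obtain ⟨δ, h1, h2⟩ := (hev.and (Ioo_mem_nhdsGT (show (0 : ℝ) < 1 / 2 by norm_num))).exists
    exact ⟨δ, h1, h2.1, h2.2⟩
  have hδ : 0 ≤ δ ∧ δ ≤ 1 := ⟨hδ0.le, by linarith⟩
  have hne : ∀ i a (p : stdSimplex ℝ (Fin 4)), p a = 1 - δ →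
      (Quot.mk _ (i, p) : Realization T) ≠ x₀ := by
    intro i a p hp
    refine mk_ne_vertexPoint fun b => ?_
    show p b < 1
    by_cases hb : b = a
    · subst hb; linarith
    · linarith [coord_add_le_one p hb]
  -- On each small triangle the lift differs from the linear interpolation by a constant.
  have hconst : ∀ i a, (Quot.mk _ (i, a) : Vertex T) = V →
      ∀ p q : stdSimplex ℝ (Fin 4), p a = 1 - δ → q a = 1 - δ →
      K (Quot.mk _ (i, p)) - interp u i a p = K (Quot.mk _ (i, q)) - interp u i a q := by
    intro i a hV p q hp hq
    refine sub_eq_sub_of_coe_eq (f := fun p => K (Quot.mk _ (i, p))) (isPreconnected_slice a (1 - δ))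
      ?_ ?_ ?_ hp hq
    · refine hKc.comp ((isQuotientMap_mk T).continuous.comp
        (Continuous.prodMk_right i)).continuousOn ?_
      exact fun p hp => ⟨hδO i a hV p hp, hne i a p hp⟩
    · intro p hp
      refine (continuousAt_interp u i a ?_).continuousWithinAt
      rw [show p a = 1 - δ from hp]; linarith
    · intro p hp
      replace hp : p a = 1 - δ := hp
      show ((K _ : ℝ) : AddCircle (1 : ℝ)) = _
      rw [hKg _ (hδO i a hV p hp) (hne i a p hp)]
      exact linkCircle_eq u (z := (i, p)) (a := a) (by show 1 / 2 < p a; rw [hp]; linarith)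
  refine ⟨fun i a => K (Quot.mk _ (i, edgePoint δ hδ a (a + 1))) -
    interp u i a (edgePoint δ hδ a (a + 1)), fun i f a haf hV => ?_⟩
  have hval : ∀ i a b, a ≠ b → (Quot.mk _ (i, a) : Vertex T) = V →
      K (Quot.mk _ (i, edgePoint δ hδ a (a + 1))) - interp u i a (edgePoint δ hδ a (a + 1)) =
        K (Quot.mk _ (i, edgePoint δ hδ a b)) - u i a b := by
    intro i a b hab hV
    have ha : a ≠ a + 1 := by clear * -; revert a; decide
    rw [hconst i a hV _ _ (edgePoint_apply_left hδ ha) (edgePoint_apply_left hδ hab),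
      interp_edgePoint u i hab hδ hδ0.ne']
  obtain ⟨b, hba, hbf⟩ := exists_ne_ne a f
  have hV' : (Quot.mk _ (T.adj i f, T.perm i f a) : Vertex T) = V := by
    rw [← hV]; exact (Quot.sound ⟨f, haf, rfl⟩).symm
  have hglue : (Quot.mk _ (i, edgePoint δ hδ a b) : Realization T) =
      Quot.mk _ (T.adj i f, edgePoint δ hδ (T.perm i f a) (T.perm i f b)) :=
    Quot.sound (pointGlue_edgePoint T hδ i haf hbf)
  have h1 := hu i f a b haf hbf hba.symm
  beta_reduce
  rw [hval i a b hba.symm hV, hval _ _ (T.perm i f b) (by simpa using hba.symm) hV', hglue]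
  linarith

/-- **Surjectivity of the quadrilateral projection** on solutions of the matching equations. The
equations have integer coefficients, so a real solution is a combination of integral ones, with
coefficients a `ℤ`-basis of the group generated by its coordinates. -/
theorem exists_stdMatching_quadProj_eq
    (hman : IsLocallyEuclideanThree (Realization T))
    {y : QuadSpace n} (hQ : QuadMatching T y) :
    ∃ x : StdSpace n, StdMatching T x ∧ quadProj n x = y := by
  classical
  set M := Submodule.span ℤ (Set.range y) with hM
  have : Module.Finite ℤ M := Module.Finite.span_of_finite ℤ (Set.finite_range y)
  have hmem : ∀ c, y c ∈ M := fun c => Submodule.subset_span ⟨c, rfl⟩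
  let β := Module.Free.chooseBasis ℤ M
  set ym : Fin n × Fin 3 → M := fun c => ⟨y c, hmem c⟩ with hym
  have hint : ∀ j, QuadMatching T (fun c => ((β.repr (ym c) j : ℤ) : ℝ)) := by
    intro j x
    have h1 : ∑ z with (rot T).SameCycle x z,
        (ym (z.1, quadSep (z.2 0) (z.2 2)) - ym (z.1, quadSep (z.2 0) (z.2 3))) = 0 := by
      apply Subtype.ext
      have h2 := hQ x
      simp only [quadSlope] at h2
      push_cast
      simpa [hym] using h2
    have h3 := congrArg (fun m => ((β.coord j m : ℤ) : ℝ)) h1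
    simp only [map_sum, map_sub, map_zero, Module.Basis.coord_apply] at h3
    push_cast at h3
    simpa [quadSlope] using h3
  choose t ht using fun j V => exists_triangles_at_vertex hman (fun c => ⟨_, rfl⟩) (hint j) V
  have hsum : ∀ c, y c = ∑ j, ((β.repr (ym c) j : ℤ) : ℝ) * (β j : ℝ) := by
    intro c
    have h1 := congrArg (Subtype.val : M → ℝ) (β.sum_repr (ym c))
    push_cast at h1
    simpa [hym] using h1.symm
  refine ⟨fun
    | (i, Sum.inl a) => ∑ j, t j (Quot.mk _ (i, a)) i a * (β j : ℝ)
    | (i, Sum.inr k) => y (i, k), fun i f a haf => ?_, rfl⟩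
  have hV : (Quot.mk _ (T.adj i f, T.perm i f a) : Vertex T) = Quot.mk _ (i, a) :=
    (Quot.sound ⟨f, haf, rfl⟩ : (Quot.mk _ (i, a) : Vertex T) = _).symm
  simp only [arcs]
  rw [hsum, hsum, ← Finset.sum_add_distrib, ← Finset.sum_add_distrib, hV]
  refine Finset.sum_congr rfl fun j _ => ?_
  rw [← add_mul, ← add_mul, ht j (Quot.mk _ (i, a)) i f a haf rfl]

/-! ### Vertex links -/

noncomputable instance : Fintype (Vertex T) := Fintype.ofFinite _

theorem Vertex.mk_glue (T : Gluing n) (i : Fin n) {f a : Fin 4} (h : a ≠ f) :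
    (Quot.mk _ (T.adj i f, T.perm i f a) : Vertex T) = Quot.mk _ (i, a) :=
  (Quot.sound ⟨f, h, rfl⟩ : (Quot.mk _ (i, a) : Vertex T) = _).symm

/-- A combination of vertex links records its coefficients as triangle coordinates. -/
theorem sum_smul_vertexLink_inl (s : Vertex T → ℝ) (i : Fin n) (a : Fin 4) :
    (∑ V, s V • vertexLink T V) (i, Sum.inl a) = s (Quot.mk _ (i, a)) := by
  classical
  simp [Finset.sum_apply, vertexLink]

theorem linearIndependent_vertexLink (T : Gluing n) : LinearIndependent ℝ (vertexLink T) := by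
  rw [Fintype.linearIndependent_iff]
  intro s hs V
  induction V using Quot.ind with | _ p =>
  rw [← sum_smul_vertexLink_inl s p.1 p.2, hs]; rfl

theorem vertexLink_nonneg (V : Vertex T) (c : Fin n × (Fin 4 ⊕ Fin 3)) :
    0 ≤ vertexLink T V c := by
  classical
  rcases c with ⟨i, a | k⟩
  · simp only [vertexLink]; split_ifs <;> norm_num
  · exact le_rfl

theorem sum_vertexLink_pos (V : Vertex T) : 0 < ∑ c, vertexLink T V c := by
  induction V using Quot.ind with | _ p =>
  refine Finset.sum_pos' (fun c _ => vertexLink_nonneg _ c) ⟨(p.1, Sum.inl p.2), Finset.mem_univ _, ?_⟩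
  simp [vertexLink]

theorem quadProj_vertexLink (V : Vertex T) : quadProj n (vertexLink T V) = 0 := rfl

open Classical in
theorem vertexLink_inl (V : Vertex T) (i : Fin n) (a : Fin 4) :
    vertexLink T V (i, Sum.inl a) = if (Quot.mk _ (i, a) : Vertex T) = V then 1 else 0 := rfl

theorem stdMatching_vertexLink (V : Vertex T) : StdMatching T (vertexLink T V) := by
  intro i f a h
  have key : vertexLink T V (T.adj i f, Sum.inl (T.perm i f a)) = vertexLink T V (i, Sum.inl a) := by
    rw [vertexLink_inl, vertexLink_inl]
    classical
    exact if_congr (Eq.congr_left (Vertex.mk_glue T i h)) rfl rfl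
  rw [arcs, arcs, key]
  rfl

/-- The solution space of the standard matching equations. -/
def stdSolutions (T : Gluing n) : Submodule ℝ (StdSpace n) where
  carrier := {x | StdMatching T x}
  add_mem' {x y} hx hy i f a h := by
    have h1 := hx i f a h
    have h2 := hy i f a h
    simp only [arcs, Pi.add_apply] at h1 h2 ⊢
    linarith
  zero_mem' i f a h := by simp [arcs]
  smul_mem' r x hx i f a h := by
    have h1 := hx i f a h
    simp only [arcs, Pi.smul_apply, smul_eq_mul] at h1 ⊢
    rw [← mul_add, h1, mul_add]

/-- The solution space of the quadrilateral matching equations. -/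
def quadSolutions (T : Gluing n) : Submodule ℝ (QuadSpace n) where
  carrier := {y | QuadMatching T y}
  add_mem' {x y} hx hy z := by
    have h : ∀ w, quadSlope (x + y) w = quadSlope x w + quadSlope y w := fun w => by
      simp only [quadSlope, Pi.add_apply]; ring
    simp only [h, Finset.sum_add_distrib, hx z, hy z, add_zero]
  zero_mem' z := by simp [quadSlope]
  smul_mem' r x hx z := by
    have h : ∀ w, quadSlope (r • x) w = r * quadSlope x w := fun w => by
      simp only [quadSlope, Pi.smul_apply, smul_eq_mul]; ring
    simp only [h, ← Finset.mul_sum, hx z, mul_zero]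

theorem mem_span_vertexLink_iff {x : StdSpace n} :
    x ∈ Submodule.span ℝ (Set.range (vertexLink T)) ↔ StdMatching T x ∧ quadProj n x = 0 := by
  constructor
  · intro hx
    have : Submodule.span ℝ (Set.range (vertexLink T)) ≤ stdSolutions T ⊓ (quadProj n).ker := by
      rw [Submodule.span_le]
      rintro _ ⟨V, rfl⟩
      exact ⟨stdMatching_vertexLink V, quadProj_vertexLink V⟩
    exact this hx
  · rintro ⟨hx, hq⟩
    have hq' : ∀ i k, x (i, Sum.inr k) = 0 := fun i k => congrFun hq (i, k)
    -- The triangle coordinates are constant on the classes of tetrahedron vertices.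
    let s : Vertex T → ℝ := Quot.lift (fun p => x (p.1, Sum.inl p.2)) (by
      rintro ⟨i, a⟩ q ⟨f, haf, rfl⟩
      have := hx i f a haf
      simpa only [arcs, hq', add_zero] using this)
    have hxs : x = ∑ V, s V • vertexLink T V := by
      ext ⟨i, a | k⟩
      · rw [sum_smul_vertexLink_inl]
      · rw [hq', Finset.sum_apply]
        exact (Finset.sum_eq_zero fun V _ => by simp [vertexLink]).symm
    rw [hxs]
    exact Submodule.sum_mem _ fun V _ => Submodule.smul_mem _ _ (Submodule.subset_span ⟨V, rfl⟩)

theorem sum_vertexLink_apply (i : Fin n) (a : Fin 4) :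
    (∑ V, vertexLink T V) (i, Sum.inl a) = 1 := by
  simpa using sum_smul_vertexLink_inl (T := T) (fun _ => 1) i a

/-- A solution with non-negative quadrilateral coordinates becomes non-negative, and non-zero,
after adding a large multiple of all vertex links. -/
theorem exists_nonneg_lift
    (hman : IsLocallyEuclideanThree (Realization T))
    {y : QuadSpace n} (hQ : QuadMatching T y) (hy : ∀ c, 0 ≤ y c) :
    ∃ x : StdSpace n, StdMatching T x ∧ quadProj n x = y ∧ ∀ c, 0 ≤ x c := by
  obtain ⟨x, hx, rfl⟩ := exists_stdMatching_quadProj_eq hman hQ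
  have hL : ∑ V, vertexLink T V ∈ stdSolutions T ⊓ (quadProj n).ker :=
    Submodule.sum_mem _ fun V _ => ⟨stdMatching_vertexLink V, quadProj_vertexLink V⟩
  refine ⟨x + (∑ c, |x c|) • ∑ V, vertexLink T V, ?_, ?_, ?_⟩
  · exact (stdSolutions T).add_mem hx ((stdSolutions T).smul_mem _ hL.1)
  · rw [map_add, map_smul, LinearMap.mem_ker.1 hL.2, smul_zero, add_zero]
  · rintro ⟨i, a | k⟩
    · rw [Pi.add_apply, Pi.smul_apply, sum_vertexLink_apply, smul_eq_mul, mul_one]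
      have := Finset.single_le_sum (f := fun c => |x c|) (fun c _ => abs_nonneg _)
        (Finset.mem_univ (i, Sum.inl a))
      linarith [neg_abs_le (x (i, Sum.inl a))]
    · have h1 : (∑ V, vertexLink T V) (i, Sum.inr k) = 0 := congrFun hL.2 (i, k)
      rw [Pi.add_apply, Pi.smul_apply, h1, smul_zero, add_zero]
      exact hy (i, k)

/-! ### Faces of sections of the non-negative orthant -/

/-- The points of the linear space `L` with non-negative coordinates of sum one. -/
def orthantSection {ι : Type} [Fintype ι] (L : Submodule ℝ (ι → ℝ)) : Set (ι → ℝ) :=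
  {x | (∀ c, 0 ≤ x c) ∧ x ∈ L ∧ ∑ c, x c = 1}

theorem convex_orthantSection {ι : Type} [Fintype ι] (L : Submodule ℝ (ι → ℝ)) :
    Convex ℝ (orthantSection L) := by
  rintro x ⟨hx0, hxL, hx1⟩ y ⟨hy0, hyL, hy1⟩ a b ha hb hab
  refine ⟨fun c => add_nonneg (mul_nonneg ha (hx0 c)) (mul_nonneg hb (hy0 c)),
    L.add_mem (L.smul_mem a hxL) (L.smul_mem b hyL), ?_⟩
  simp only [Pi.add_apply, Pi.smul_apply, smul_eq_mul, Finset.sum_add_distrib, ← Finset.mul_sum,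
    hx1, hy1, mul_one, hab]

theorem inv_sum_smul_mem_orthantSection {ι : Type} [Fintype ι] {L : Submodule ℝ (ι → ℝ)}
    {x : ι → ℝ} (h0 : ∀ c, 0 ≤ x c) (hL : x ∈ L) (hs : 0 < ∑ c, x c) :
    (∑ c, x c)⁻¹ • x ∈ orthantSection L := by
  refine ⟨fun c => mul_nonneg (inv_nonneg.2 hs.le) (h0 c), L.smul_mem _ hL, ?_⟩
  simp only [Pi.smul_apply, smul_eq_mul, ← Finset.mul_sum]
  exact inv_mul_cancel₀ hs.ne'

theorem isExposed_support {ι : Type} [Fintype ι] (L : Submodule ℝ (ι → ℝ)) (J : Set ι) :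
    IsExposed ℝ (orthantSection L) {x ∈ orthantSection L | ∀ c ∉ J, x c = 0} := by
  classical
  rintro ⟨w, hw, hwJ⟩
  set l : StrongDual ℝ (ι → ℝ) :=
    -∑ c with c ∉ J, ContinuousLinearMap.proj (R := ℝ) (φ := fun _ : ι => ℝ) c with hl
  have hlx : ∀ x, l x = -∑ c with c ∉ J, x c := by
    intro x
    simp [hl]
  refine ⟨l, Set.ext fun x => and_congr_right fun hx => ⟨fun h z hz => ?_, fun h c hc => ?_⟩⟩
  · have h1 : ∑ c with c ∉ J, x c = 0 :=
      Finset.sum_eq_zero fun c hc => h c (Finset.mem_filter.1 hc).2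
    rw [hlx, hlx, h1, neg_zero, neg_nonpos]
    exact Finset.sum_nonneg fun c _ => hz.1 c
  · have h1 := h w hw
    have h2 : ∑ c with c ∉ J, w c = 0 :=
      Finset.sum_eq_zero fun c hc => hwJ c (Finset.mem_filter.1 hc).2
    rw [hlx, hlx, h2, neg_zero, neg_nonneg] at h1
    have h3 := Finset.sum_nonneg fun c (_ : c ∈ Finset.univ.filter (· ∉ J)) => hx.1 c
    exact (Finset.sum_eq_zero_iff_of_nonneg fun c _ => hx.1 c).1 (le_antisymm h1 h3) c (by simpa)

/-- The average of sufficiently many points of a non-empty face lies in its relative interior. -/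
theorem exists_full_support {ι : Type} [Fintype ι] {L : Submodule ℝ (ι → ℝ)}
    {F : Set (ι → ℝ)} (hF : IsExposed ℝ (orthantSection L) F) (hne : F.Nonempty) :
    ∃ z ∈ F, ∀ c, (∃ x ∈ F, x c ≠ 0) → z c ≠ 0 := by
  classical
  obtain ⟨w, hw⟩ := hne
  have hcard : 0 < (Fintype.card ι : ℝ) := by
    have : Nonempty ι := by
      by_contra h
      rw [not_nonempty_iff] at h
      have := (hF.subset hw).2.2
      simp at this
    exact_mod_cast Fintype.card_pos
  have hx : ∀ c, ∃ x ∈ F, (∃ x ∈ F, x c ≠ 0) → x c ≠ 0 := by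
    intro c
    by_cases h : ∃ x ∈ F, x c ≠ 0
    · obtain ⟨x, hx, hxc⟩ := h
      exact ⟨x, hx, fun _ => hxc⟩
    · exact ⟨w, hw, fun h' => absurd h' h⟩
  choose x hxF hxc using hx
  refine ⟨∑ c, (Fintype.card ι : ℝ)⁻¹ • x c, (hF.convex (convex_orthantSection L)).sum_mem
    (fun _ _ => by positivity) ?_ (fun c _ => hxF c), fun c hc => ?_⟩
  · simp [hcard.ne']
  · have h0 : ∀ d, 0 ≤ ((Fintype.card ι : ℝ)⁻¹ • x d) c := fun d =>
      mul_nonneg (by positivity) ((hF.subset (hxF d)).1 c)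
    rw [Finset.sum_apply]
    refine (Finset.sum_pos' (fun d _ => h0 d) ⟨c, Finset.mem_univ _, ?_⟩).ne'
    exact mul_pos (inv_pos.2 hcard) (lt_of_le_of_ne ((hF.subset (hxF c)).1 c) (hxc c hc).symm)

/-- A face is determined by the coordinates that do not vanish on it: from a relative interior
point of the face one can move a little away from any other point with the same zeros. -/
theorem eq_support_of_isExposed {ι : Type} [Fintype ι] {L : Submodule ℝ (ι → ℝ)}
    {F : Set (ι → ℝ)} (hF : IsExposed ℝ (orthantSection L) F) :
    F = {x ∈ orthantSection L | ∀ c ∉ {c | ∃ x ∈ F, x c ≠ 0}, x c = 0} := by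
  apply Set.Subset.antisymm
  · intro x hx
    refine ⟨hF.subset hx, fun c hc => ?_⟩
    by_contra h
    exact hc ⟨x, hx, h⟩
  rintro x ⟨hx, hxc⟩
  rcases F.eq_empty_or_nonempty with rfl | hne
  · have : ∑ c, x c = 0 := Finset.sum_eq_zero fun c _ => hxc c (by simp)
    rw [hx.2.2] at this
    exact absurd this one_ne_zero
  obtain ⟨z, hzF, hz⟩ := exists_full_support hF hne
  have hzP := hF.subset hzF
  obtain ⟨ε, hε, hε0, hε1⟩ : ∃ ε : ℝ, (∀ c, ε * x c ≤ z c) ∧ 0 < ε ∧ ε < 1 := by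
    have hev : ∀ᶠ ε : ℝ in nhdsWithin 0 (Set.Ioi 0), ∀ c, ε * x c ≤ z c := by
      rw [Filter.eventually_all]
      intro c
      by_cases hc : ∃ x ∈ F, x c ≠ 0
      · have hzc : 0 < z c := lt_of_le_of_ne (hzP.1 c) (hz c hc).symm
        have ht : Filter.Tendsto (fun ε : ℝ => ε * x c) (nhdsWithin 0 (Set.Ioi 0)) (nhds 0) := by
          have : Filter.Tendsto (fun ε : ℝ => ε * x c) (nhds 0) (nhds (0 * x c)) :=
            (continuous_id.mul continuous_const).tendsto 0
          rw [zero_mul] at this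
          exact this.mono_left nhdsWithin_le_nhds
        exact (ht.eventually (gt_mem_nhds hzc)).mono fun ε h => h.le
      · rw [hxc c hc]
        exact Filter.Eventually.of_forall fun ε => by rw [mul_zero]; exact hzP.1 c
    obtain ⟨ε, h1, h2⟩ := (hev.and (Ioo_mem_nhdsGT (zero_lt_one' ℝ))).exists
    exact ⟨ε, h1, h2.1, h2.2⟩
  obtain ⟨l, hl⟩ := hF hne
  rw [hl] at hzF
  have hsum : ∑ c, (z - ε • x) c = 1 - ε := by
    simp [Finset.sum_sub_distrib, ← Finset.mul_sum, hzP.2.2, hx.2.2]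
  have hmem := inv_sum_smul_mem_orthantSection (L := L) (x := z - ε • x)
    (fun c => sub_nonneg.2 (hε c)) (L.sub_mem hzP.2.1 (L.smul_mem ε hx.2.1))
    (by rw [hsum]; linarith)
  have h1 := hzF.2 _ hmem
  rw [hsum, map_smul, map_sub, map_smul, smul_eq_mul, smul_eq_mul,
    inv_mul_le_iff₀ (by linarith)] at h1
  have h2 : l z ≤ l x := by nlinarith
  rw [hl]
  exact ⟨hx, fun y hy => (hzF.2 y hy).trans h2⟩

/-! ### Dimensions -/

theorem finrank_map_add_finrank_inf_ker {E E' : Type*} [AddCommGroup E] [Module ℝ E]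
    [AddCommGroup E'] [Module ℝ E'] [FiniteDimensional ℝ E] (f : E →ₗ[ℝ] E')
    (W : Submodule ℝ E) :
    Module.finrank ℝ (W.map f) + Module.finrank ℝ (W ⊓ f.ker : Submodule ℝ E) =
      Module.finrank ℝ W := by
  have h1 := (f.domRestrict W).finrank_range_add_finrank_ker
  rw [LinearMap.range_domRestrict, LinearMap.ker_domRestrict] at h1
  rw [← h1, ← Submodule.map_comap_subtype, Submodule.finrank_map_subtype_eq]

theorem faceDim_eq_finrank_span_sub_one {ι : Type} [Fintype ι] {F : Set (ι → ℝ)}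
    (hF : ∀ x ∈ F, ∑ c, x c = 1) :
    faceDim F = (Module.finrank ℝ (Submodule.span ℝ F) : ℤ) - 1 := by
  classical
  unfold faceDim
  split_ifs with hne
  swap
  · obtain rfl := Set.not_nonempty_iff_eq_empty.1 hne
    rw [Submodule.span_empty, finrank_bot]; rfl
  obtain ⟨p, hp⟩ := hne
  let φ : (ι → ℝ) →ₗ[ℝ] ℝ := ∑ c, LinearMap.proj c
  have hφ : ∀ x, φ x = ∑ c, x c := fun x => by simp [φ]
  have hmap : (Submodule.span ℝ F).map φ = ⊤ := by
    rw [eq_top_iff]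
    intro r _
    exact ⟨r • p, Submodule.smul_mem _ _ (Submodule.subset_span hp), by
      rw [map_smul, hφ, hF p hp, smul_eq_mul, mul_one]⟩
  have hker : Submodule.span ℝ F ⊓ φ.ker = vectorSpan ℝ F := by
    apply le_antisymm
    · rintro x ⟨hx, hx0⟩
      have key : ∀ x ∈ Submodule.span ℝ F, x - φ x • p ∈ vectorSpan ℝ F := by
        intro x hx
        induction hx using Submodule.span_induction with
        | mem x hx =>
          rw [hφ, hF x hx, one_smul]
          exact vsub_mem_vectorSpan ℝ hx hp
        | zero => simp
        | add x y _ _ hx hy =>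
          rw [map_add, add_smul, add_sub_add_comm]
          exact Submodule.add_mem _ hx hy
        | smul r x _ hx =>
          rw [map_smul, smul_eq_mul, mul_smul, ← smul_sub]
          exact Submodule.smul_mem _ _ hx
      simpa [LinearMap.mem_ker.1 hx0] using key x hx
    · rw [vectorSpan_def, Submodule.span_le]
      rintro _ ⟨x, hx, y, hy, rfl⟩
      refine ⟨Submodule.sub_mem _ (Submodule.subset_span hx) (Submodule.subset_span hy), ?_⟩
      rw [SetLike.mem_coe, LinearMap.mem_ker]
      show φ (x - y) = 0
      rw [map_sub, hφ, hφ, hF x hx, hF y hy, sub_self]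
  have h := finrank_map_add_finrank_inf_ker φ (Submodule.span ℝ F)
  rw [hmap, hker, finrank_top, Module.finrank_self] at h
  omega

/-! ### Corresponding faces -/

/-- The face of `S` where the quadrilateral coordinates outside `K` vanish. -/
def stdFace (T : Gluing n) (K : Set (Fin n × Fin 3)) : Set (StdSpace n) :=
  {x ∈ stdProj T | ∀ c ∉ K, quadProj n x c = 0}

/-- The face of `Q` where the coordinates outside `K` vanish. -/
def quadFace (T : Gluing n) (K : Set (Fin n × Fin 3)) : Set (QuadSpace n) :=
  {y ∈ quadProjSpace T | ∀ c ∉ K, y c = 0}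

theorem isExposed_stdFace (T : Gluing n) (K : Set (Fin n × Fin 3)) :
    IsExposed ℝ (stdProj T) (stdFace T K) := by
  have h : stdFace T K = {x ∈ orthantSection (stdSolutions T) |
      ∀ c ∉ {c : Fin n × (Fin 4 ⊕ Fin 3) | ∀ k, c.2 = Sum.inr k → (c.1, k) ∈ K}, x c = 0} := by
    ext x
    refine and_congr_right fun _ => ⟨?_, fun h c hc => h (c.1, Sum.inr c.2) fun h' => hc (h' _ rfl)⟩
    rintro h ⟨i, a | k⟩ hc
    · exact absurd (fun k hk => by simp at hk) hc
    · refine h (i, k) fun hk => hc fun k' hk' => ?_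
      cases hk'
      exact hk
  rw [h]
  exact isExposed_support (stdSolutions T) _

theorem isExposed_quadFace (T : Gluing n) (K : Set (Fin n × Fin 3)) :
    IsExposed ℝ (quadProjSpace T) (quadFace T K) :=
  isExposed_support (quadSolutions T) K

theorem exists_eq_quadFace {G : Set (QuadSpace n)} (hG : IsExposed ℝ (quadProjSpace T) G) :
    ∃ K, G = quadFace T K :=
  ⟨_, eq_support_of_isExposed (L := quadSolutions T) hG⟩

/-- Every admissible face of `S` extends to an admissible face that does not restrict the triangle
coordinates. -/
theorem exists_le_stdFace {F : Set (StdSpace n)}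
    (hF : IsAdmissibleFace (fun x => QuadConstraints (quadProj n x)) (stdProj T) F) :
    ∃ K, F ⊆ stdFace T K ∧
      IsAdmissibleFace (fun x => QuadConstraints (quadProj n x)) (stdProj T) (stdFace T K) := by
  refine ⟨{c | ∃ x ∈ F, quadProj n x c ≠ 0}, fun x hx => ⟨hF.1.subset hx, fun c hc => ?_⟩,
    isExposed_stdFace T _, fun x hx i k l hk hl => ?_⟩
  · by_contra h
    exact hc ⟨x, hx, h⟩
  · have hk' : ∃ x ∈ F, quadProj n x (i, k) ≠ 0 := by
      by_contra h
      exact hk (hx.2 _ h)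
    have hl' : ∃ x ∈ F, quadProj n x (i, l) ≠ 0 := by
      by_contra h
      exact hl (hx.2 _ h)
    obtain ⟨w, hw, -⟩ := id hk'
    obtain ⟨z, hzF, hz⟩ := exists_full_support (L := stdSolutions T) hF.1 ⟨w, hw⟩
    exact hF.2 z hzF i k l (hz (i, Sum.inr k) hk') (hz (i, Sum.inr l) hl')

/-- A point of `stdFace T K` with non-zero quadrilateral part projects into the open cone over
`quadFace T K`. -/
theorem quadProj_eq_zero_or {K : Set (Fin n × Fin 3)} {x : StdSpace n} (hx : x ∈ stdFace T K) :
    quadProj n x = 0 ∨ ∃ r : ℝ, 0 < r ∧ ∃ y ∈ quadFace T K, quadProj n x = r • y := by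
  have h0 : ∀ c, 0 ≤ quadProj n x c := fun c => hx.1.1 (c.1, Sum.inr c.2)
  rcases (Finset.sum_nonneg fun c (_ : c ∈ Finset.univ) => h0 c).eq_or_lt with hs | hs
  · left
    ext c
    exact (Finset.sum_eq_zero_iff_of_nonneg fun c _ => h0 c).1 hs.symm c (Finset.mem_univ c)
  · right
    refine ⟨_, hs, (∑ c, quadProj n x c)⁻¹ • quadProj n x,
      ⟨inv_sum_smul_mem_orthantSection (L := quadSolutions T) h0 hx.1.2.1.quadMatching hs,
        fun c hc => ?_⟩, ?_⟩
    · rw [Pi.smul_apply, hx.2 c hc, smul_zero]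
    · rw [smul_smul, mul_inv_cancel₀ hs.ne', one_smul]

/-- Every point of `quadFace T K` is, up to a positive factor, the projection of a point of
`stdFace T K`. -/
theorem exists_stdFace_lift
    (hman : IsLocallyEuclideanThree (Realization T))
    {K : Set (Fin n × Fin 3)} {y : QuadSpace n} (hy : y ∈ quadFace T K) :
    ∃ r : ℝ, 0 < r ∧ ∃ x ∈ stdFace T K, y = r • quadProj n x := by
  obtain ⟨x, hx, rfl, h0⟩ := exists_nonneg_lift hman hy.1.2.1 hy.1.1
  have hs : 0 < ∑ c, x c := by
    refine lt_of_le_of_ne (Finset.sum_nonneg fun c _ => h0 c) fun hs => ?_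
    have h1 := (Finset.sum_eq_zero_iff_of_nonneg fun c _ => h0 c).1 hs.symm
    have h2 : ∑ c, quadProj n x c = 0 :=
      Finset.sum_eq_zero fun c _ => h1 (c.1, Sum.inr c.2) (Finset.mem_univ _)
    rw [hy.1.2.2] at h2
    exact one_ne_zero h2
  refine ⟨_, hs, (∑ c, x c)⁻¹ • x,
    ⟨inv_sum_smul_mem_orthantSection (L := stdSolutions T) h0 hx hs, fun c hc => ?_⟩, ?_⟩
  · rw [map_smul, Pi.smul_apply, hy.2 c hc, smul_zero]
  · rw [map_smul, smul_smul, mul_inv_cancel₀ hs.ne', one_smul]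

theorem vertexLink_mem_stdFace (K : Set (Fin n × Fin 3)) (V : Vertex T) :
    (∑ c, vertexLink T V c)⁻¹ • vertexLink T V ∈ stdFace T K := by
  refine ⟨inv_sum_smul_mem_orthantSection (L := stdSolutions T) (vertexLink_nonneg V)
    (stdMatching_vertexLink V) (sum_vertexLink_pos V), fun c _ => ?_⟩
  rw [map_smul, quadProj_vertexLink, smul_zero]; rfl

theorem quadProj_image_coneOver_stdFace (hman : IsLocallyEuclideanThree (Realization T))
    (K : Set (Fin n × Fin 3)) :
    quadProj n '' coneOver (stdFace T K) = coneOver (quadFace T K) := by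
  ext y
  constructor
  · rintro ⟨_, rfl | ⟨r, hr, x, hx, rfl⟩, rfl⟩
    · exact Or.inl (map_zero _)
    · rcases quadProj_eq_zero_or hx with h | ⟨s, hs, y, hy, h⟩
      · left
        rw [map_smul, h, smul_zero]; rfl
      · right
        exact ⟨r * s, mul_nonneg hr hs.le, y, hy, by rw [map_smul, h, smul_smul]⟩
  · rintro (rfl | ⟨r, hr, y, hy, rfl⟩)
    · exact ⟨0, Or.inl rfl, map_zero _⟩
    · obtain ⟨s, hs, x, hx, rfl⟩ := exists_stdFace_lift hman hy
      exact ⟨(r * s) • x, Or.inr ⟨_, mul_nonneg hr hs.le, x, hx, rfl⟩, by rw [map_smul, smul_smul]⟩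

theorem faceMap_stdFace (hman : IsLocallyEuclideanThree (Realization T))
    (K : Set (Fin n × Fin 3)) : faceMap (stdFace T K) = quadFace T K := by
  rw [faceMap, quadProj_image_coneOver_stdFace hman]
  ext y
  constructor
  · rintro ⟨rfl | ⟨r, hr, y, hy, rfl⟩, h1⟩
    · simp at h1
    · have h2 : r = 1 := by
        simpa [← Finset.mul_sum, hy.1.2.2] using h1
      rwa [h2, one_smul]
  · intro hy
    exact ⟨Or.inr ⟨1, zero_le_one, y, hy, (one_smul ℝ y).symm⟩, hy.1.2.2⟩

theorem stdFace_subset_iff (hman : IsLocallyEuclideanThree (Realization T))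
    (K K' : Set (Fin n × Fin 3)) : stdFace T K ⊆ stdFace T K' ↔ quadFace T K ⊆ quadFace T K' := by
  constructor
  · intro h y hy
    obtain ⟨r, hr, x, hx, rfl⟩ := exists_stdFace_lift hman hy
    refine ⟨hy.1, fun c hc => ?_⟩
    rw [Pi.smul_apply, (h hx).2 c hc, smul_zero]
  · intro h x hx
    refine ⟨hx.1, fun c hc => ?_⟩
    rcases quadProj_eq_zero_or hx with h0 | ⟨s, hs, y, hy, h0⟩
    · rw [h0]; rfl
    · rw [h0, Pi.smul_apply, (h hy).2 c hc, smul_zero]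

theorem isAdmissibleFace_stdFace_iff (hman : IsLocallyEuclideanThree (Realization T))
    (K : Set (Fin n × Fin 3)) :
    IsAdmissibleFace (fun x => QuadConstraints (quadProj n x)) (stdProj T) (stdFace T K) ↔
      IsAdmissibleFace QuadConstraints (quadProjSpace T) (quadFace T K) := by
  refine ⟨fun h => ⟨isExposed_quadFace T K, fun y hy i k l hk hl => ?_⟩,
    fun h => ⟨isExposed_stdFace T K, fun x hx i k l hk hl => ?_⟩⟩
  · obtain ⟨r, hr, x, hx, rfl⟩ := exists_stdFace_lift hman hy
    exact h.2 x hx i k l (right_ne_zero_of_mul hk) (right_ne_zero_of_mul hl)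
  · rcases quadProj_eq_zero_or hx with h0 | ⟨s, hs, y, hy, h0⟩
    · rw [h0] at hk
      exact absurd rfl hk
    · rw [h0] at hk hl
      exact h.2 y hy i k l (right_ne_zero_of_mul hk) (right_ne_zero_of_mul hl)

theorem stdFace_mem_stdMaxFaces_iff (hman : IsLocallyEuclideanThree (Realization T))
    (K : Set (Fin n × Fin 3)) :
    stdFace T K ∈ stdMaxFaces T ↔ quadFace T K ∈ quadMaxFaces T := by
  constructor
  · intro h
    refine ⟨(isAdmissibleFace_stdFace_iff hman K).1 h.1, fun G hG hle => ?_⟩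
    obtain ⟨K', rfl⟩ := exists_eq_quadFace hG.1
    exact (stdFace_subset_iff hman K' K).1
      (h.2 ((isAdmissibleFace_stdFace_iff hman K').2 hG) ((stdFace_subset_iff hman K K').2 hle))
  · intro h
    refine ⟨(isAdmissibleFace_stdFace_iff hman K).2 h.1, fun F hF hle => ?_⟩
    obtain ⟨K', hFK, hadm⟩ := exists_le_stdFace hF
    exact hFK.trans ((stdFace_subset_iff hman K' K).2
      (h.2 ((isAdmissibleFace_stdFace_iff hman K').1 hadm)
        ((stdFace_subset_iff hman K K').1 (hle.trans hFK))))

theorem faceDim_stdFace (hman : IsLocallyEuclideanThree (Realization T))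
    (K : Set (Fin n × Fin 3)) :
    faceDim (stdFace T K) = faceDim (quadFace T K) + (numVertices T : ℤ) := by
  rw [faceDim_eq_finrank_span_sub_one fun x hx => hx.1.2.2,
    faceDim_eq_finrank_span_sub_one fun y hy => hy.1.2.2]
  have hmap : (Submodule.span ℝ (stdFace T K)).map (quadProj n) =
      Submodule.span ℝ (quadFace T K) := by
    rw [Submodule.map_span]
    apply le_antisymm <;> rw [Submodule.span_le]
    · rintro _ ⟨x, hx, rfl⟩
      rcases quadProj_eq_zero_or hx with h0 | ⟨s, hs, y, hy, h0⟩
      · rw [h0]; exact Submodule.zero_mem _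
      · rw [h0]; exact Submodule.smul_mem _ _ (Submodule.subset_span hy)
    · intro y hy
      obtain ⟨r, hr, x, hx, rfl⟩ := exists_stdFace_lift hman hy
      exact Submodule.smul_mem _ _ (Submodule.subset_span ⟨x, hx, rfl⟩)
  have hker : Submodule.span ℝ (stdFace T K) ⊓ (quadProj n).ker =
      Submodule.span ℝ (Set.range (vertexLink T)) := by
    apply le_antisymm
    · rintro x ⟨hx, hx0⟩
      have hle : Submodule.span ℝ (stdFace T K) ≤ stdSolutions T :=
        Submodule.span_le.2 fun x hx => hx.1.2.1
      exact mem_span_vertexLink_iff.2 ⟨hle hx, hx0⟩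
    · rw [Submodule.span_le]
      rintro _ ⟨V, rfl⟩
      refine ⟨?_, quadProj_vertexLink V⟩
      have h := Submodule.smul_mem _ (∑ c, vertexLink T V c)
        (Submodule.subset_span (R := ℝ) (vertexLink_mem_stdFace K V))
      rwa [smul_smul, mul_inv_cancel₀ (sum_vertexLink_pos V).ne', one_smul] at h
  have h := finrank_map_add_finrank_inf_ker (quadProj n) (Submodule.span ℝ (stdFace T K))
  rw [hmap, hker, finrank_span_eq_card (linearIndependent_vertexLink T),
    ← Nat.card_eq_fintype_card] at h
  rw [← h, numVertices]
  push_cast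
  ring

theorem exists_eq_stdFace {F : Set (StdSpace n)} (hF : F ∈ stdMaxFaces T) :
    ∃ K, F = stdFace T K := by
  obtain ⟨K, hle, hadm⟩ := exists_le_stdFace hF.1
  exact ⟨K, Set.Subset.antisymm hle (hF.2 hadm hle)⟩

end NormalSurface

theorem lemma6p1 {n : ℕ} (T : NormalSurface.Gluing n)
    (hconn : ConnectedSpace (NormalSurface.Realization T))
    (hman : NormalSurface.IsClosedThreeManifold (NormalSurface.Realization T)) :
    -- the quadrilateral projection induces a bijection between the maximal admissible faces
    Set.BijOn NormalSurface.faceMap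
      (NormalSurface.stdMaxFaces T) (NormalSurface.quadMaxFaces T) ∧
    -- at the level of cones this bijection is the image under the projection
    (∀ F ∈ NormalSurface.stdMaxFaces T,
      NormalSurface.quadProj n '' NormalSurface.coneOver F =
        NormalSurface.coneOver (NormalSurface.faceMap F)) ∧
    -- it sends faces of dimension `i + v` to faces of dimension `i`
    (∀ F ∈ NormalSurface.stdMaxFaces T,
      NormalSurface.faceDim F =
        NormalSurface.faceDim (NormalSurface.faceMap F) + (NormalSurface.numVertices T : ℤ)) ∧
    -- every maximal admissible face contains all vertex links (rescaled to coordinate sum one)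
    (∀ F ∈ NormalSurface.stdMaxFaces T, ∀ V : NormalSurface.Vertex T,
      (∑ c, NormalSurface.vertexLink T V c)⁻¹ • NormalSurface.vertexLink T V ∈ F) ∧
    -- the vertex links form a basis of the kernel of the projection on the solution space of
    -- the standard matching equations
    LinearIndependent ℝ (NormalSurface.vertexLink T) ∧
    ∀ x : NormalSurface.StdSpace n,
      x ∈ Submodule.span ℝ (Set.range (NormalSurface.vertexLink T)) ↔
        NormalSurface.StdMatching T x ∧ NormalSurface.quadProj n x = 0 := by
  have hloc := hman.2.2.2
  refine ⟨⟨fun F hF => ?_, fun F hF F' hF' h => ?_, fun G hG => ?_⟩, fun F hF => ?_, fun F hF => ?_,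
    fun F hF V => ?_, NormalSurface.linearIndependent_vertexLink T,
    fun x => NormalSurface.mem_span_vertexLink_iff⟩
  · obtain ⟨K, rfl⟩ := NormalSurface.exists_eq_stdFace hF
    rw [NormalSurface.faceMap_stdFace hloc]
    exact (NormalSurface.stdFace_mem_stdMaxFaces_iff hloc K).1 hF
  · obtain ⟨K, rfl⟩ := NormalSurface.exists_eq_stdFace hF
    obtain ⟨K', rfl⟩ := NormalSurface.exists_eq_stdFace hF'
    rw [NormalSurface.faceMap_stdFace hloc, NormalSurface.faceMap_stdFace hloc] at h
    exact Set.Subset.antisymm ((NormalSurface.stdFace_subset_iff hloc K K').2 h.le)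
      ((NormalSurface.stdFace_subset_iff hloc K' K).2 h.ge)
  · obtain ⟨K, rfl⟩ := NormalSurface.exists_eq_quadFace hG.1.1
    exact ⟨NormalSurface.stdFace T K, (NormalSurface.stdFace_mem_stdMaxFaces_iff hloc K).2 hG,
      NormalSurface.faceMap_stdFace hloc K⟩
  · obtain ⟨K, rfl⟩ := NormalSurface.exists_eq_stdFace hF
    rw [NormalSurface.faceMap_stdFace hloc, NormalSurface.quadProj_image_coneOver_stdFace hloc]
  · obtain ⟨K, rfl⟩ := NormalSurface.exists_eq_stdFace hF
    rw [NormalSurface.faceMap_stdFace hloc]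
    exact NormalSurface.faceDim_stdFace hloc K
  · obtain ⟨K, rfl⟩ := NormalSurface.exists_eq_stdFace hF
    exact NormalSurface.vertexLink_mem_stdFace K V
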